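/- Let $W$ be a path-continuous, centred Gaussian random field on $\mathbb{R}^d$ that is intrinsically stationary (for every $h$, the field $x\mapsto W(x+h)-W(x)$ is weakly stationary), with variogram $\gamma(h)=\tfrac12\mathbb{E}(W(h)-W(0))^2$ and variance $\sigma^2(t)=\operatorname{Var}W(t)$. Put $\xi(t)=W(t)-\sigma^2(t)/2$ and assume $\xi(t)\to-\infty$ almost surely as $|t|\to\infty$. Let $$M=\sup_{t}\xi(t),\qquad T=\inf\{t:\xi(t)=M\}\ \text{(coordinatewise infimum)},\qquad F=\xi(\cdot+T)-M,$$ let $C(\mathbb{R}^d)$ carry the $\sigma$-algebra generated by the point evaluations, and define the measure $\Psi$ on $\mathbb{R}^d\times\mathbb{R}\times C(\mathbb{R}^d)$ by $$\Psi(A)=\int_{\mathbb{R}}e^{-x}\,\mathbb{P}\big((T,x+M,F)\in A\big)\,dx .$$ For measurable $A\subset C(\mathbb{R}^d)$ put $$\lambda(A)=\int_{[0,1]^d\times[0,1]\times A}e^{y}\,d\Psi(t,y,f),\qquad \lambda^*=\lambda(C(\mathbb{R}^d)),\qquad Q=\lambda/\lambda^* .$$ Then $0<\lambda^*<\infty$,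 $Q$ is a probability measure on $C(\mathbb{R}^d)$, and $d\Psi(t,y,f)=\lambda^*e^{-y}\,dt\,dy\,Q(df)$. Moreover, let $\sum_{i\in\mathbb{N}}\delta_{(S_i,U_i)}$ be a Poisson point process on $\mathbb{R}^d\times\mathbb{R}$ with intensity measure $\lambda^*e^{-u}\,du\,ds$, and let $\tilde F_i$, $i\in\mathbb{N}$, be i.i.d. with law $Q$, the sequence $(\tilde F_i)_i$ being independent of the sequence $((S_i,U_i))_i$. Let $Z$ be a Brown–Resnick process with variogram $\gamma$, that is, $$Z(t)=\max_{i\in\mathbb{N}}\Big(X_i+V_i(t)-\tfrac12\operatorname{Var}V_i(t)\Big),\qquad t\in\mathbb{R}^d,$$ where $V_i$, $i\in\mathbb{N}$, are i.i.d. path-continuous, centred, intrinsically stationary Gaussian random fields with variogram $\gamma$ (for example independent copies of $W$), and $\sum_i\delta_{X_i}$ is a Poisson point process on $\mathbb{R}$ with intensity measure $e^{-x}dx$ such that $(X_i)_i$ is independent of $(V_i)_i$. Then, almost surely, the maximum defining $Z(t)$ and the maximum $$Z_4(t)=\max_{i\in\mathbb{N}}\big(U_i+\tilde F_i(t-S_i)\big)$$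 exist for all $t\in\mathbb{R}^d$, and $Z_4$ is a Brown–Resnick process with variogram $\gamma$: the processes $(Z_4(t))_{t\in\mathbb{R}^d}$ and $(Z(t))_{t\in\mathbb{R}^d}$ have the same law (that is, the same finite-dimensional distributions). -/

import Mathlib

open MeasureTheory ProbabilityTheory Filter Topology Set
open scoped ENNReal

noncomputable section

namespace BrownResnick

/-- The Euclidean space `ℝᵈ`. -/
abbrev E (d : ℕ) : Type := EuclideanSpace ℝ (Fin d)

/-- The space `C(ℝᵈ)` of continuous real functions carries the `σ`-algebra generated by the
evaluations at points. -/
instance instMeasurableSpaceContinuousMap (d : ℕ) : MeasurableSpace C(E d, ℝ) :=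
  MeasurableSpace.comap (fun f : C(E d, ℝ) => fun t : E d => f t) MeasurableSpace.pi

/-! ### Poisson point processes -/

/-- The number of points (with multiplicity) of `∑ᵢ δ_{X i}` in the set `A`. -/
def pointCount {Ω S : Type*} (X : ℕ → Ω → S) (A : Set S) (ω : Ω) : ℕ∞ :=
  {i : ℕ | X i ω ∈ A}.encard

/-- `∑ᵢ δ_{X i}` is a Poisson point process with intensity measure `μ`. If `μ A = ∞`, the Poisson
law with parameter `μ A` is the point mass at `∞`. -/
structure IsPoissonProcess {Ω S : Type*} [MeasurableSpace Ω] [MeasurableSpace S]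
    (P : Measure Ω) (X : ℕ → Ω → S) (μ : Measure S) : Prop where
  measurable : ∀ i, Measurable (X i)
  law_of_ne_top : ∀ A, MeasurableSet A → μ A ≠ ∞ →
    P.map (pointCount X A) = (poissonMeasure (μ A).toNNReal).map (fun n : ℕ => (n : ℕ∞))
  law_of_eq_top : ∀ A, MeasurableSet A → μ A = ∞ → ∀ᵐ ω ∂P, pointCount X A ω = ⊤
  indep : ∀ (n : ℕ) (A : Fin n → Set S), (∀ j, MeasurableSet (A j)) →
    Pairwise (fun j k => Disjoint (A j) (A k)) → iIndepFun (fun j => pointCount X (A j)) P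

/-- The measure `e^{-x} dx` on `ℝ`. -/
def expIntensity : Measure ℝ :=
  (volume : Measure ℝ).withDensity (fun x => ENNReal.ofReal (Real.exp (-x)))

/-! ### Intrinsically stationary Gaussian fields -/

/-- Weak stationarity of a random field on `ℝᵈ`. -/
structure IsWeaklyStationary {d : ℕ} {Ω : Type*} [MeasurableSpace Ω]
    (P : Measure Ω) (Y : E d → Ω → ℝ) : Prop where
  memLp : ∀ t, MemLp (Y t) 2 P
  mean : ∀ s t, ∫ ω, Y s ω ∂P = ∫ ω, Y t ω ∂P
  cov : ∀ x s t, covariance (Y (x + s)) (Y s) P = covariance (Y (x + t)) (Y t) P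

/-- `W` is a path-continuous, centred, intrinsically stationary Gaussian random field on `ℝᵈ`
with (semi-)variogram `γ`. -/
structure IsGaussianFieldWithVariogram {d : ℕ} {Ω : Type*} [MeasurableSpace Ω]
    (P : Measure Ω) (W : Ω → C(E d, ℝ)) (γ : E d → ℝ) : Prop where
  measurable : Measurable W
  gaussian : IsGaussianProcess (fun (t : E d) (ω : Ω) => W ω t) P
  mean_zero : ∀ t, ∫ ω, W ω t ∂P = 0
  intrinsic : ∀ h : E d, IsWeaklyStationary P (fun (x : E d) (ω : Ω) => W ω (x + h) - W ω x)
  variogram : ∀ h : E d, γ h = (1 / 2) * ∫ ω, (W ω h - W ω 0) ^ 2 ∂P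

/-- The field `ξ(t) = W(t) - σ²(t) / 2`, where `σ²(t) = Var W(t)`. -/
def drifted {d : ℕ} {Ω : Type*} [MeasurableSpace Ω] (P : Measure Ω) (W : Ω → C(E d, ℝ))
    (ω : Ω) (t : E d) : ℝ :=
  W ω t - variance (fun ω' => W ω' t) P / 2

/-! ### The processes `Z` and `Z₄` -/

/-- The `i`-th term `X i + W i t - σ²(t) / 2` in the definition of a Brown–Resnick process. -/
def brownResnickTerm {d : ℕ} {Ω : Type*} [MeasurableSpace Ω] (P : Measure Ω)
    (X : ℕ → Ω → ℝ) (W : ℕ → Ω → C(E d, ℝ)) (ω : Ω) (t : E d) (i : ℕ) : ℝ :=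
  X i ω + drifted P (W i) ω t

/-- The process `Z`. -/
def brownResnick {d : ℕ} {Ω : Type*} [MeasurableSpace Ω] (P : Measure Ω)
    (X : ℕ → Ω → ℝ) (W : ℕ → Ω → C(E d, ℝ)) (ω : Ω) (t : E d) : ℝ :=
  ⨆ i : ℕ, brownResnickTerm P X W ω t i

/-- The ingredients of a Brown–Resnick process for the variogram `γ`: independent copies `W i`
of a Gaussian field with variogram `γ`, and an independent Poisson process `∑ᵢ δ_{X i}` with
intensity `e^{-x} dx`. -/
structure IsBrownResnickData {d : ℕ} {Ω : Type*} [MeasurableSpace Ω] (P : Measure Ω)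
    (X : ℕ → Ω → ℝ) (W : ℕ → Ω → C(E d, ℝ)) (γ : E d → ℝ) : Prop where
  field : ∀ i, IsGaussianFieldWithVariogram P (W i) γ
  identDistrib : ∀ i, IdentDistrib (W i) (W 0) P P
  iIndep : iIndepFun W P
  poisson : IsPoissonProcess P X expIntensity
  indep : IndepFun (fun ω i => X i ω) (fun ω i => W i ω) P

/-- The `i`-th term `U i + F i (t - S i)` in the definition of `Z₄`; the points of the Poisson
process are `SU i = (S i, U i)`. -/
def shiftTerm {d : ℕ} {Ω : Type*} (SU : ℕ → Ω → E d × ℝ) (F : ℕ → Ω → C(E d, ℝ))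
    (ω : Ω) (t : E d) (i : ℕ) : ℝ :=
  (SU i ω).2 + F i ω (t - (SU i ω).1)

/-- The process `Z₄`. -/
def shiftProcess {d : ℕ} {Ω : Type*} (SU : ℕ → Ω → E d × ℝ) (F : ℕ → Ω → C(E d, ℝ))
    (ω : Ω) (t : E d) : ℝ :=
  ⨆ i : ℕ, shiftTerm SU F ω t i

/-! ### The constant `λ*` and the law `Q` -/

/-- `M = sup ξ`. -/
def peakValue {d : ℕ} (ξ : E d → ℝ) : ℝ := ⨆ t, ξ t

/-- `T = inf (argsup ξ)`, the infimum in `ℝᵈ` being taken coordinatewise. -/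
def peakLocation {d : ℕ} (ξ : E d → ℝ) : E d :=
  WithLp.toLp 2 (fun k : Fin d => sInf ((fun t : E d => t k) '' {t | ∀ s, ξ s ≤ ξ t}))

open Classical in
/-- A continuous function, regarded as an element of `C(ℝᵈ)`. (It is applied to `ξ` shifted, which
is continuous since the variance function of a path-continuous Gaussian field is continuous.) -/
def toContinuousMap {d : ℕ} (g : E d → ℝ) : C(E d, ℝ) :=
  if h : Continuous g then ⟨g, h⟩ else 0

/-- `F = ξ(· + T) - M`. -/
def peakShape {d : ℕ} (ξ : E d → ℝ) : C(E d, ℝ) :=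
  toContinuousMap (fun t => ξ (t + peakLocation ξ) - peakValue ξ)

/-- The measure `Ψ(A) = ∫ e^{-x} ℙ((T, x + M, F) ∈ A) dx` on `ℝᵈ × ℝ × C(ℝᵈ)`. -/
def peakIntensity {d : ℕ} {Ω : Type*} [MeasurableSpace Ω] (P : Measure Ω)
    (W : Ω → C(E d, ℝ)) : Measure (E d × ℝ × C(E d, ℝ)) :=
  (expIntensity.prod P).map (fun p : ℝ × Ω =>
    (peakLocation (drifted P W p.2), p.1 + peakValue (drifted P W p.2),
      peakShape (drifted P W p.2)))

/-- The set `[0,1]ᵈ × [0,1] × C(ℝᵈ)`. -/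
def unitBlock (d : ℕ) : Set (E d × ℝ × C(E d, ℝ)) :=
  {p | (∀ k, p.1 k ∈ Icc (0 : ℝ) 1) ∧ p.2.1 ∈ Icc (0 : ℝ) 1}

/-- The measure `λ(A) = ∫_{[0,1]ᵈ × [0,1] × A} e^y dΨ(t,y,f)` on `C(ℝᵈ)`. -/
def shapeMeasure {d : ℕ} {Ω : Type*} [MeasurableSpace Ω] (P : Measure Ω)
    (W : Ω → C(E d, ℝ)) : Measure C(E d, ℝ) :=
  (((peakIntensity P W).restrict (unitBlock d)).withDensity
    (fun p => ENNReal.ofReal (Real.exp p.2.1))).map (fun p => p.2.2)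

/-- `λ* = λ(C(ℝᵈ))`. -/
def lambdaStar {d : ℕ} {Ω : Type*} [MeasurableSpace Ω] (P : Measure Ω)
    (W : Ω → C(E d, ℝ)) : ℝ≥0∞ :=
  shapeMeasure P W univ

/-- `Q = λ / λ*`. -/
def shapeLaw {d : ℕ} {Ω : Type*} [MeasurableSpace Ω] (P : Measure Ω)
    (W : Ω → C(E d, ℝ)) : Measure C(E d, ℝ) :=
  (lambdaStar P W)⁻¹ • shapeMeasure P W

/-- The ingredients of `Z₄`: a Poisson process `∑ᵢ δ_{(S i, U i)}` with intensity
`l e^{-u} du ds`, and independent `F i` with law `Q`, independent of the Poisson process. -/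
structure IsShiftData {d : ℕ} {Ω : Type*} [MeasurableSpace Ω] (P : Measure Ω)
    (SU : ℕ → Ω → E d × ℝ) (F : ℕ → Ω → C(E d, ℝ)) (l : ℝ≥0∞) (Q : Measure C(E d, ℝ)) :
    Prop where
  poisson : IsPoissonProcess P SU (l • (volume : Measure (E d)).prod expIntensity)
  measurable : ∀ i, Measurable (F i)
  law : ∀ i, P.map (F i) = Q
  iIndep : iIndepFun F P
  indep : IndepFun (fun ω i => SU i ω) (fun ω i => F i ω) P

end BrownResnick

end

noncomputable section

namespace BrownResnick

/-! ### Measurability in `C(ℝᵈ)` -/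

variable {d : ℕ}

/-! Both `Z` and `Z₄` are pointwise maxima of random functions obtained by marking a Poisson process
independently. The law of such a maximum is fixed by the intensity measure of the functions on
`C(ℝᵈ)`: the maximum stays below `y` at finitely many points exactly when no function exceeds `y`
there, and this void probability is `exp (-Λ B)`. It thus suffices to show that both families have
the same locally finite intensity `Λ`.

For `Z`, `Λ` is the image of `e^{-x} dx ⊗ P` under `x + ξ` (`functionIntensity`). Pulling the value
at the origin out of the field rewrites `Λ` through the law of `ξ - ξ(0)` under the density
`e^{ξ(0)}`. The exponential moments of that law involve weights summing to one, so the variances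
cancel and only `γ` remains (`lintegral_exp_sum`). Hence `Λ` depends on `γ` alone
(`functionIntensity_eq`). Since spatial translates of `W` have the same variogram, `Λ` is invariant
under spatial shifts, while adding a constant `c` changes it only by an exponential factor
(`lintegral_functionIntensity_translate`). Fernique's theorem gives local finiteness.

Splitting a function that tends to `-∞` into location, height and shape of its peak is equivariant
and invertible, and carries `Λ` to `Ψ`. So for each set `A` of shapes, `e^y Ψ(dt, dy, A)` is
translation invariant on `ℝᵈ × ℝ`. A mass transport argument makes it finite on a box
(`peakIntensity_box_lt_top`), and uniqueness of Haar measure makes it a multiple of Lebesgue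
measure: this is the product form of `Ψ`. Inverting the peak map exhibits `Λ` as the intensity of
the functions `U i + F i (· - S i)` (`functionIntensity_eq_map_shift`). -/

lemma measurable_eval (t : E d) : Measurable (fun f : C(E d, ℝ) => f t) :=
  (measurable_pi_apply t).comp (comap_measurable _)

lemma measurable_coe : Measurable (fun (f : C(E d, ℝ)) (t : E d) => f t) :=
  comap_measurable _

lemma measurable_continuousMap_iff {α : Type*} [MeasurableSpace α] {φ : α → C(E d, ℝ)} :
    Measurable φ ↔ ∀ t, Measurable fun a => φ a t := by
  rw [measurable_comap_iff, measurable_pi_iff]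
  rfl

lemma measurable_uncurry_eval : Measurable (fun p : C(E d, ℝ) × E d => p.1 p.2) :=
  (measurable_uncurry_of_continuous_of_measurable
    (u := fun (t : E d) (f : C(E d, ℝ)) => f t) (fun f => f.continuous) measurable_eval).comp
    measurable_swap

/-- The translate `f(· + h) + c`. -/
def translate (h : E d) (c : ℝ) (f : C(E d, ℝ)) : C(E d, ℝ) :=
  ⟨fun t => f (t + h) + c, by fun_prop⟩

@[simp] lemma translate_apply (h : E d) (c : ℝ) (f : C(E d, ℝ)) (t : E d) :
    translate h c f t = f (t + h) + c := rfl

lemma measurable_translate_uncurry :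
    Measurable (fun p : E d × ℝ × C(E d, ℝ) => translate p.1 p.2.1 p.2.2) := by
  rw [measurable_continuousMap_iff]
  intro t
  have h1 : Measurable (fun p : E d × ℝ × C(E d, ℝ) => (p.2.2, t + p.1)) := by fun_prop
  exact (measurable_uncurry_eval.comp h1).add (by fun_prop)

lemma measurable_translate (h : E d) (c : ℝ) : Measurable (translate (d := d) h c) := by
  rw [measurable_continuousMap_iff]
  exact fun t => (measurable_eval _).add_const _

lemma translate_translate (h h' : E d) (c c' : ℝ) (f : C(E d, ℝ)) :
    translate h c (translate h' c' f) = translate (h + h') (c + c') f := by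
  ext t
  simp only [translate_apply, add_assoc]
  ring

@[simp] lemma translate_zero_zero (f : C(E d, ℝ)) : translate 0 0 f = f := by
  ext t
  simp

/-! ### The measure `e^{-x} dx` -/

instance : SigmaFinite expIntensity := by
  unfold expIntensity
  infer_instance

lemma measurable_expDensity : Measurable (fun x : ℝ => ENNReal.ofReal (Real.exp (-x))) := by
  fun_prop

lemma lintegral_expIntensity {f : ℝ → ℝ≥0∞} (hf : Measurable f) :
    ∫⁻ x, f x ∂expIntensity = ∫⁻ x, ENNReal.ofReal (Real.exp (-x)) * f x := by
  unfold expIntensity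
  rw [lintegral_withDensity_eq_lintegral_mul _ measurable_expDensity hf]
  rfl

/-- The scaling rule of `e^{-x} dx` under shifts, from which all exponential tilts below arise. -/
lemma lintegral_expIntensity_add {f : ℝ → ℝ≥0∞} (hf : Measurable f) (c : ℝ) :
    ∫⁻ x, f (x + c) ∂expIntensity = ENNReal.ofReal (Real.exp c) * ∫⁻ x, f x ∂expIntensity := by
  rw [lintegral_expIntensity hf,
    lintegral_expIntensity (f := fun x => f (x + c)) (hf.comp (measurable_add_const c)),
    ← lintegral_const_mul _ (by fun_prop),
    ← lintegral_add_right_eq_self (fun x => ENNReal.ofReal (Real.exp c) *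
      (ENNReal.ofReal (Real.exp (-x)) * f x)) c]
  refine lintegral_congr fun x => ?_
  rw [← mul_assoc, ← ENNReal.ofReal_mul (Real.exp_pos _).le, ← Real.exp_add]
  congr 3
  ring

lemma expIntensity_Ioi (y : ℝ) : expIntensity (Ioi y) = ENNReal.ofReal (Real.exp (-y)) := by
  rw [expIntensity, withDensity_apply _ measurableSet_Ioi,
    ← ofReal_integral_eq_lintegral_ofReal (integrableOn_exp_neg_Ioi y)
      (ae_of_all _ fun x => (Real.exp_pos _).le), integral_exp_neg_Ioi]

lemma expIntensity_univ : expIntensity univ = ∞ := by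
  refine top_unique (le_of_forall_lt fun r hr => ?_)
  lift r to NNReal using hr.ne
  obtain ⟨y, hy⟩ : ∃ y : ℝ, (r : ℝ) < Real.exp (-y) :=
    ⟨-Real.log (r + 1), by rw [neg_neg, Real.exp_log (by positivity)]; linarith⟩
  calc (r : ℝ≥0∞) = ENNReal.ofReal r := by simp
    _ < ENNReal.ofReal (Real.exp (-y)) := (ENNReal.ofReal_lt_ofReal_iff (Real.exp_pos _)).2 hy
    _ = expIntensity (Ioi y) := (expIntensity_Ioi y).symm
    _ ≤ _ := measure_mono (subset_univ _)

/-! ### The drifted field -/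

section Field

variable {Ω : Type*} [MeasurableSpace Ω] {P : Measure Ω} {W : Ω → C(E d, ℝ)} {γ : E d → ℝ}

namespace IsGaussianFieldWithVariogram

variable (hW : IsGaussianFieldWithVariogram P W γ)
include hW

lemma measurable_eval (t : E d) : Measurable (fun ω => W ω t) :=
  (BrownResnick.measurable_eval t).comp hW.measurable

lemma isProbabilityMeasure : IsProbabilityMeasure P := hW.gaussian.isProbabilityMeasure

lemma memLp (t : E d) : MemLp (fun ω => W ω t) 2 P :=
  (hW.gaussian.hasGaussianLaw_eval t).memLp_two

end IsGaussianFieldWithVariogram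

end Field

/-! ### Exponential moments of a Gaussian field -/

lemma lintegral_exp_of_hasGaussianLaw {Ω : Type*} [MeasurableSpace Ω] {P : Measure Ω}
    {Y : Ω → ℝ} (hY : HasGaussianLaw Y P) (h0 : ∫ ω, Y ω ∂P = 0) :
    ∫⁻ ω, ENNReal.ofReal (Real.exp (Y ω)) ∂P =
      ENNReal.ofReal (Real.exp (variance Y P / 2)) := by
  have hmap := hY.map_eq_gaussianReal
  have hm := mgf_gaussianReal hmap 1
  have hint : Integrable (fun ω => Real.exp (1 * Y ω)) P := by
    have := integrable_exp_mul_gaussianReal (μ := P[Y]) (v := Var[Y; P].toNNReal) 1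
    rw [← hmap] at this
    exact this.comp_aemeasurable hY.aemeasurable
  simp only [one_mul] at hint
  rw [← ofReal_integral_eq_lintegral_ofReal hint (ae_of_all _ fun _ => (Real.exp_pos _).le)]
  simp only [mgf, one_mul, h0, zero_add, mul_one, one_pow] at hm
  rw [hm, Real.coe_toNNReal _ (variance_nonneg _ _)]

lemma toContinuousMap_apply {g : E d → ℝ} (hg : Continuous g) (t : E d) :
    toContinuousMap g t = g t := by
  rw [toContinuousMap, dif_pos hg]
  rfl

/-- The field `ξ` as a random element of `C(ℝᵈ)`. -/
def driftedMap {Ω : Type*} [MeasurableSpace Ω] (P : Measure Ω) (W : Ω → C(E d, ℝ)) (ω : Ω) :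
    C(E d, ℝ) :=
  toContinuousMap (drifted P W ω)

namespace IsGaussianFieldWithVariogram

variable {Ω : Type*} [MeasurableSpace Ω] {P : Measure Ω} {W : Ω → C(E d, ℝ)} {γ : E d → ℝ}
variable (hW : IsGaussianFieldWithVariogram P W γ)
include hW

/-! ### Second-order structure and exponential moments of the field -/

lemma variance_sub (s t : E d) : variance (fun ω => W ω s - W ω t) P = 2 * γ (s - t) := by
  have := hW.isProbabilityMeasure
  have h := (hW.intrinsic (s - t)).cov 0 t 0
  have hm : ∀ a b : E d, AEMeasurable (fun ω => W ω a - W ω b) P := fun a b =>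
    ((hW.measurable_eval a).sub (hW.measurable_eval b)).aemeasurable
  simp only [zero_add, add_sub_cancel] at h
  rw [covariance_self (hm _ _), covariance_self (hm _ _)] at h
  rw [h, hW.variogram, variance_of_integral_eq_zero (hm _ _)]
  · ring
  · rw [integral_sub ((hW.memLp _).integrable one_le_two) ((hW.memLp _).integrable one_le_two),
      hW.mean_zero, hW.mean_zero, sub_zero]

lemma covariance_eq (s t : E d) :
    covariance (fun ω => W ω s) (fun ω => W ω t) P =
      (variance (fun ω => W ω s) P + variance (fun ω => W ω t) P) / 2 - γ (s - t) := by
  have := hW.isProbabilityMeasure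
  have h := variance_fun_sub (hW.memLp s) (hW.memLp t)
  rw [hW.variance_sub] at h
  linarith

lemma hasGaussianLaw_sum {ι : Type*} [Fintype ι] (t : ι → E d) (c : ι → ℝ) :
    HasGaussianLaw (fun ω => ∑ i, c i * W ω (t i)) P :=
  ((hW.gaussian.comp_right t).smul c).hasGaussianLaw_fun_sum

lemma integral_sum {ι : Type*} [Fintype ι] (t : ι → E d) (c : ι → ℝ) :
    ∫ ω, ∑ i, c i * W ω (t i) ∂P = 0 := by
  have := hW.isProbabilityMeasure
  rw [integral_finsetSum _ fun i _ => ((hW.memLp _).integrable one_le_two).const_mul _]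
  simp [integral_const_mul, hW.mean_zero]

/-- Each covariance is half the sum of two variances minus `γ`; weights of total one collapse the
variance terms of the double sum to a single sum. -/
lemma variance_sum {ι : Type*} [Fintype ι] (t : ι → E d) (c : ι → ℝ) (hc : ∑ i, c i = 1) :
    variance (fun ω => ∑ i, c i * W ω (t i)) P =
      ∑ i, c i * variance (fun ω => W ω (t i)) P - ∑ i, ∑ j, c i * c j * γ (t i - t j) := by
  have := hW.isProbabilityMeasure
  rw [variance_fun_sum (fun i => (hW.memLp (t i)).const_mul (c i))]
  simp_rw [covariance_const_mul_left, covariance_const_mul_right, hW.covariance_eq]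
  have h1 : ∀ i j, c i * (c j * ((variance (fun ω => W ω (t i)) P +
      variance (fun ω => W ω (t j)) P) / 2 - γ (t i - t j))) =
      c i * variance (fun ω => W ω (t i)) P / 2 * c j +
      c i * (c j * variance (fun ω => W ω (t j)) P / 2) - c i * c j * γ (t i - t j) := by
    intro i j
    ring
  simp_rw [h1, Finset.sum_sub_distrib, Finset.sum_add_distrib, ← Finset.mul_sum, ← Finset.sum_mul,
    hc, ← Finset.sum_div]
  ring

/-- The drift `-σ²/2` cancels exactly the single sum of variances in `variance_sum`, so that only
the variogram survives. -/
lemma lintegral_exp_sum {ι : Type*} [Fintype ι] (t : ι → E d) (c : ι → ℝ)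
    (hc : ∑ i, c i = 1) :
    ∫⁻ ω, ENNReal.ofReal (Real.exp (∑ i, c i * drifted P W ω (t i))) ∂P =
      ENNReal.ofReal (Real.exp (-(∑ i, ∑ j, c i * c j * γ (t i - t j)) / 2)) := by
  have h := lintegral_exp_of_hasGaussianLaw (hW.hasGaussianLaw_sum t c) (hW.integral_sum t c)
  rw [hW.variance_sum t c hc] at h
  have h1 : ∀ ω, ∑ i, c i * drifted P W ω (t i) = (∑ i, c i * W ω (t i)) +
      -(∑ i, c i * variance (fun ω => W ω (t i)) P) / 2 := by
    intro ω
    simp_rw [drifted, mul_sub, Finset.sum_sub_distrib, mul_div_assoc', ← Finset.sum_div]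
    ring
  simp_rw [h1, Real.exp_add, ENNReal.ofReal_mul (Real.exp_pos _).le]
  rw [lintegral_mul_const' _ _ ENNReal.ofReal_ne_top, h, ← ENNReal.ofReal_mul (Real.exp_pos _).le,
    ← Real.exp_add]
  congr 2
  ring

/-- The characteristic function of `W t` at `1` is `exp (-σ²(t)/2)`; it is continuous in `t` by
dominated convergence along the continuous paths, and a logarithm recovers `σ²`. -/
lemma continuous_variance : Continuous (fun t => variance (fun ω => W ω t) P) := by
  have := hW.isProbabilityMeasure
  have key : ∀ t, charFun (P.map (fun ω => W ω t)) 1 =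
      Complex.exp (((-(variance (fun ω => W ω t) P) / 2 : ℝ) : ℂ)) := by
    intro t
    rw [(hW.gaussian.hasGaussianLaw_eval t).map_eq_gaussianReal, charFun_gaussianReal,
      hW.mean_zero t, Real.coe_toNNReal _ (variance_nonneg _ _)]
    congr 1
    push_cast
    ring
  have hcont : Continuous (fun t => charFun (P.map (fun ω => W ω t)) 1) := by
    have : ∀ t, charFun (P.map (fun ω => W ω t)) 1 =
        ∫ ω, Complex.exp ((W ω t : ℂ) * Complex.I) ∂P := by
      intro t
      rw [charFun_apply_real, integral_map (hW.measurable_eval t).aemeasurable (by fun_prop)]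
      simp
    simp_rw [this]
    refine continuous_of_dominated (bound := fun _ => 1) ?_ ?_ (integrable_const _) ?_
    · intro t
      have := hW.measurable_eval t
      exact Measurable.aestronglyMeasurable (by fun_prop)
    · exact fun t => ae_of_all _ fun ω => by rw [Complex.norm_exp_ofReal_mul_I]
    · exact ae_of_all _ fun ω => by fun_prop
  have h2 : ∀ t, variance (fun ω => W ω t) P =
      -2 * Real.log (charFun (P.map (fun ω => W ω t)) 1).re := by
    intro t
    rw [key, ← Complex.ofReal_exp, Complex.ofReal_re, Real.log_exp]
    ring
  simp_rw [h2]
  refine continuous_const.mul (Continuous.log (Complex.continuous_re.comp hcont) fun t => ?_)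
  rw [key, ← Complex.ofReal_exp, Complex.ofReal_re]
  exact (Real.exp_pos _).ne'

lemma continuous_drifted (ω : Ω) : Continuous (drifted P W ω) :=
  (W ω).continuous.sub (hW.continuous_variance.div_const 2)

lemma driftedMap_apply (ω : Ω) (t : E d) : driftedMap P W ω t = drifted P W ω t :=
  toContinuousMap_apply (hW.continuous_drifted ω) t

lemma measurable_driftedMap : Measurable (driftedMap P W) := by
  rw [measurable_continuousMap_iff]
  intro t
  simp_rw [hW.driftedMap_apply, drifted]
  exact (hW.measurable_eval t).sub_const _

end IsGaussianFieldWithVariogram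

/-! ### Laws on `C(ℝᵈ)` with prescribed exponential moments -/

/-- Finite exponential moments of every order make the complex moment generating function entire, so
equality on the real axis extends to the whole plane and identifies the laws. -/
lemma map_eq_of_lintegral_exp_eq {α β : Type*} [MeasurableSpace α] [MeasurableSpace β]
    {μ : Measure α} {ν : Measure β} [IsProbabilityMeasure μ] [IsProbabilityMeasure ν]
    {X : α → ℝ} {Y : β → ℝ} (hX : Measurable X) (hY : Measurable Y)
    (hfin : ∀ u : ℝ, ∫⁻ a, ENNReal.ofReal (Real.exp (u * X a)) ∂μ ≠ ∞)
    (h : ∀ u : ℝ, ∫⁻ a, ENNReal.ofReal (Real.exp (u * X a)) ∂μ =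
      ∫⁻ b, ENNReal.ofReal (Real.exp (u * Y b)) ∂ν) :
    μ.map X = ν.map Y := by
  have hmgf : mgf X μ = mgf Y ν := by
    ext u
    rw [mgf, mgf, integral_eq_lintegral_of_nonneg_ae (ae_of_all _ fun _ => (Real.exp_pos _).le)
      (Measurable.aestronglyMeasurable (by fun_prop)), integral_eq_lintegral_of_nonneg_ae
      (ae_of_all _ fun _ => (Real.exp_pos _).le) (Measurable.aestronglyMeasurable (by fun_prop)),
      h u]
  have huniv : integrableExpSet X μ = univ := by
    refine eq_univ_of_forall fun u => ?_
    refine ⟨Measurable.aestronglyMeasurable (by fun_prop), ?_⟩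
    rw [hasFiniteIntegral_iff_ofReal (ae_of_all _ fun _ => (Real.exp_pos _).le)]
    exact (hfin u).lt_top
  refine Measure.ext_of_complexMGF_eq hX.aemeasurable hY.aemeasurable (funext fun z => ?_)
  exact eqOn_complexMGF_of_mgf hmgf (by simp [huniv])

lemma measurable_linearCombination {I : Finset (E d)} (a : I → ℝ) :
    Measurable fun f : C(E d, ℝ) => ∑ i : I, a i * f i :=
  Finset.measurable_sum _ fun i _ => (measurable_eval (i : E d)).const_mul _

lemma strongDual_pi_apply {ι : Type*} [Fintype ι] [DecidableEq ι] (L : StrongDual ℝ (ι → ℝ))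
    (x : ι → ℝ) : L x = ∑ i, L (Pi.single i 1) * x i := by
  conv_lhs => rw [pi_eq_sum_univ' x, map_sum]
  refine Finset.sum_congr rfl fun i _ => ?_
  rw [map_smul, smul_eq_mul, mul_comm]

/-- The Cramér–Wold device identifies the finite-dimensional marginals, and these determine a finite
measure on the σ-algebra generated by evaluations. -/
lemma continuousMap_measure_ext {μ ν : Measure C(E d, ℝ)} [IsFiniteMeasure μ] [IsFiniteMeasure ν]
    (h : ∀ (I : Finset (E d)) (a : I → ℝ),
      μ.map (fun f => ∑ i, a i * f i) = ν.map (fun f => ∑ i, a i * f i)) : μ = ν := by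
  have hproj : ∀ μ : Measure C(E d, ℝ), IsProjectiveLimit (μ.map fun f (t : E d) => f t)
      (fun I : Finset (E d) => μ.map fun f (i : I) => f i) := by
    intro μ I
    rw [Measure.map_map (Finset.measurable_restrict I) measurable_coe]
    rfl
  have hm : ∀ I : Finset (E d), Measurable (fun (f : C(E d, ℝ)) (i : I) => f i) := fun I =>
    measurable_pi_iff.2 fun i => measurable_eval _
  have hmap : (μ.map fun f (t : E d) => f t) = ν.map fun f (t : E d) => f t := by
    refine (hproj μ).unique ?_
    intro I
    rw [hproj ν I]
    refine Measure.ext_of_charFunDual (funext fun L => ?_)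
    rw [charFunDual_eq_charFun_map_one, charFunDual_eq_charFun_map_one,
      Measure.map_map (by fun_prop) (hm I), Measure.map_map (by fun_prop) (hm I)]
    have : (L ∘ fun (f : C(E d, ℝ)) (i : I) => f i) =
        fun f => ∑ i : I, L (Pi.single i 1) * f i := by
      ext f
      exact strongDual_pi_apply L _
    rw [this, h I]
  ext s hs
  obtain ⟨t, ht, rfl⟩ := hs
  rw [← Measure.map_apply measurable_coe ht, hmap, Measure.map_apply measurable_coe ht]

/-! ### The intensity measure of the functions `X i + ξ i` -/

/-- The image of `e^{-x} dx ⊗ P` under `(x, ω) ↦ x + ξ(ω)`. -/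
def functionIntensity {Ω : Type*} [MeasurableSpace Ω] (P : Measure Ω) (W : Ω → C(E d, ℝ)) :
    Measure C(E d, ℝ) :=
  (expIntensity.prod P).map (fun p : ℝ × Ω => translate 0 p.1 (driftedMap P W p.2))

/-- The law of `ξ - ξ(0)` under the measure with density `e^{ξ(0)}`. -/
def tiltedLaw {Ω : Type*} [MeasurableSpace Ω] (P : Measure Ω) (W : Ω → C(E d, ℝ)) :
    Measure C(E d, ℝ) :=
  (P.withDensity fun ω => ENNReal.ofReal (Real.exp (driftedMap P W ω 0))).map
    (fun ω => translate 0 (-driftedMap P W ω 0) (driftedMap P W ω))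

namespace IsGaussianFieldWithVariogram

variable {Ω : Type*} [MeasurableSpace Ω] {P : Measure Ω} {W : Ω → C(E d, ℝ)} {γ : E d → ℝ}
variable (hW : IsGaussianFieldWithVariogram P W γ)
include hW

lemma measurable_driftedMap_eval (t : E d) : Measurable (fun ω => driftedMap P W ω t) :=
  (BrownResnick.measurable_eval t).comp hW.measurable_driftedMap

lemma measurable_translate_driftedMap :
    Measurable (fun p : ℝ × Ω => translate 0 p.1 (driftedMap P W p.2)) :=
  measurable_translate_uncurry.comp
    (measurable_const.prodMk (measurable_fst.prodMk (hW.measurable_driftedMap.comp measurable_snd)))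

lemma measurable_increment :
    Measurable (fun ω => translate 0 (-driftedMap P W ω 0) (driftedMap P W ω)) :=
  measurable_translate_uncurry.comp (measurable_const.prodMk
    ((hW.measurable_driftedMap_eval 0).neg.prodMk hW.measurable_driftedMap))

/-- The density `e^{ξ(0)}` brings the total weight to one: the index `none` stands for the origin
and carries the weight `1 - ∑ a i`. -/
lemma lintegral_tiltedLaw_exp {I : Finset (E d)} (a : I → ℝ) :
    ∫⁻ f, ENNReal.ofReal (Real.exp (∑ i, a i * f i)) ∂(tiltedLaw P W) =
      ENNReal.ofReal (Real.exp (-(∑ i : Option I, ∑ j : Option I,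
        (i.elim (1 - ∑ i, a i) a) * (j.elim (1 - ∑ i, a i) a) *
          γ (i.elim 0 (fun i => (i : E d)) - j.elim 0 (fun i => (i : E d)))) / 2)) := by
  rw [← hW.lintegral_exp_sum (fun i : Option I => i.elim 0 (fun i => (i : E d)))
    (fun i => i.elim (1 - ∑ i, a i) a) (by simp [Fintype.sum_option]), tiltedLaw, lintegral_map
    _ hW.measurable_increment, lintegral_withDensity_eq_lintegral_mul]
  · refine lintegral_congr fun ω => ?_
    simp only [Pi.mul_apply, Fintype.sum_option, Option.elim_none, Option.elim_some,
      translate_apply, add_zero, hW.driftedMap_apply]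
    rw [← ENNReal.ofReal_mul (Real.exp_pos _).le, ← Real.exp_add]
    congr 2
    simp_rw [mul_add, Finset.sum_add_distrib, ← Finset.sum_mul]
    ring
  · have := hW.measurable_driftedMap_eval 0
    fun_prop
  · exact (measurable_linearCombination a).exp.ennreal_ofReal.comp hW.measurable_increment
  · exact (measurable_linearCombination a).exp.ennreal_ofReal

lemma isProbabilityMeasure_tiltedLaw : IsProbabilityMeasure (tiltedLaw P W) := by
  constructor
  have h := hW.lintegral_tiltedLaw_exp (I := ∅) (fun _ => 0)
  have h0 : γ 0 = 0 := by
    have := hW.variance_sub 0 0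
    simp only [sub_self] at this
    have h1 : variance (fun _ : Ω => (0 : ℝ)) P = 0 := variance_zero P
    linarith
  simpa [h0] using h

lemma tiltedLaw_eq {Ω' : Type*} [MeasurableSpace Ω'] {P' : Measure Ω'} {W' : Ω' → C(E d, ℝ)}
    (hW' : IsGaussianFieldWithVariogram P' W' γ) : tiltedLaw P W = tiltedLaw P' W' := by
  have := hW.isProbabilityMeasure_tiltedLaw
  have := hW'.isProbabilityMeasure_tiltedLaw
  refine continuousMap_measure_ext fun I a => ?_
  refine map_eq_of_lintegral_exp_eq (measurable_linearCombination a)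
    (measurable_linearCombination a) ?_ ?_
  · intro u
    simp_rw [Finset.mul_sum, ← mul_assoc]
    rw [hW.lintegral_tiltedLaw_exp (fun i => u * a i)]
    exact ENNReal.ofReal_ne_top
  · intro u
    simp_rw [Finset.mul_sum, ← mul_assoc]
    rw [hW.lintegral_tiltedLaw_exp (fun i => u * a i), hW'.lintegral_tiltedLaw_exp]

/-- For fixed `ω`, substitute `x + ξ(0)` for `x`: the function `x + ξ` becomes the new level plus `ξ
- ξ(0)`, and the factor `e^{ξ(0)}` produced by `e^{-x} dx` is the tilting density. -/
lemma functionIntensity_eq_map_tiltedLaw : functionIntensity P W =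
    (expIntensity.prod (tiltedLaw P W)).map (fun p => translate 0 p.1 p.2) := by
  have := hW.isProbabilityMeasure
  have := hW.isProbabilityMeasure_tiltedLaw
  have hm : Measurable (fun p : ℝ × C(E d, ℝ) => translate 0 p.1 p.2) :=
    measurable_translate_uncurry.comp (measurable_const.prodMk measurable_id)
  ext A hA
  rw [functionIntensity, Measure.map_apply hW.measurable_translate_driftedMap hA,
    Measure.map_apply hm hA, ← lintegral_indicator_one (hm hA),
    ← lintegral_indicator_one (hW.measurable_translate_driftedMap hA),
    lintegral_prod_symm _ (measurable_one.indicator (hm hA)).aemeasurable,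
    lintegral_prod_symm _
      (measurable_one.indicator (hW.measurable_translate_driftedMap hA)).aemeasurable]
  have hmi : Measurable (fun f : C(E d, ℝ) => ∫⁻ x, ((fun p : ℝ × C(E d, ℝ) =>
      translate 0 p.1 p.2) ⁻¹' A).indicator (1 : ℝ × C(E d, ℝ) → ℝ≥0∞) (x, f) ∂expIntensity) :=
    (measurable_one.indicator (hm hA)).lintegral_prod_left'
  have hcomp := hmi.comp hW.measurable_increment
  simp only [Function.comp_def] at hcomp
  rw [tiltedLaw, lintegral_map hmi hW.measurable_increment,
    lintegral_withDensity_eq_lintegral_mul _ (by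
      have := hW.measurable_driftedMap_eval 0
      fun_prop) hcomp]
  refine lintegral_congr fun ω => ?_
  simp only [Pi.mul_apply]
  rw [← lintegral_expIntensity_add]
  · refine lintegral_congr fun x => ?_
    have he : BrownResnick.translate 0 (x + driftedMap P W ω 0)
        (BrownResnick.translate 0 (-driftedMap P W ω 0) (driftedMap P W ω)) =
        BrownResnick.translate 0 x (driftedMap P W ω) := by
      rw [translate_translate, add_zero, add_neg_cancel_right]
    change A.indicator (1 : C(E d, ℝ) → ℝ≥0∞) (BrownResnick.translate 0 x (driftedMap P W ω)) =
      A.indicator (1 : C(E d, ℝ) → ℝ≥0∞) (BrownResnick.translate 0 (x + driftedMap P W ω 0)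
        (BrownResnick.translate 0 (-driftedMap P W ω 0) (driftedMap P W ω)))
    rw [he]
  · exact (measurable_one.indicator (hm hA)).comp measurable_prodMk_right

/-- The intensity measure depends on the variogram only. -/
lemma functionIntensity_eq {Ω' : Type*} [MeasurableSpace Ω'] {P' : Measure Ω'}
    {W' : Ω' → C(E d, ℝ)} (hW' : IsGaussianFieldWithVariogram P' W' γ) :
    functionIntensity P W = functionIntensity P' W' := by
  rw [hW.functionIntensity_eq_map_tiltedLaw, hW'.functionIntensity_eq_map_tiltedLaw,
    hW.tiltedLaw_eq hW']

/-- The translated field is again a Gaussian field with the same variogram. -/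
lemma translate (h : E d) :
    IsGaussianFieldWithVariogram P (fun ω => BrownResnick.translate h 0 (W ω)) γ where
  measurable := (measurable_translate h 0).comp hW.measurable
  gaussian := by
    simp only [translate_apply, add_zero]
    exact hW.gaussian.comp_right (fun t => t + h)
  mean_zero t := by simpa using hW.mean_zero (t + h)
  intrinsic k := by
    have := hW.intrinsic k
    refine ⟨fun t => ?_, fun s t => ?_, fun x s t => ?_⟩
    · simpa [add_right_comm] using this.memLp (t + h)
    · simpa [add_right_comm] using this.mean (s + h) (t + h)
    · have hcov := this.cov x (s + h) (t + h)
      simp only [← add_assoc] at hcov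
      simpa [add_right_comm _ k h] using hcov
  variogram k := by
    have := hW.isProbabilityMeasure
    have h1 := hW.variance_sub (k + h) h
    rw [add_sub_cancel_right, variance_of_integral_eq_zero] at h1
    · simp only [translate_apply, add_zero, zero_add]
      linarith
    · exact ((hW.measurable_eval _).sub (hW.measurable_eval _)).aemeasurable
    · rw [integral_sub ((hW.memLp _).integrable one_le_two) ((hW.memLp _).integrable one_le_two),
        hW.mean_zero, hW.mean_zero, sub_zero]

lemma driftedMap_translate (h : E d) (ω : Ω) :
    driftedMap P (fun ω => BrownResnick.translate h 0 (W ω)) ω =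
      BrownResnick.translate h 0 (driftedMap P W ω) := by
  ext t
  rw [(hW.translate h).driftedMap_apply]
  simp [hW.driftedMap_apply, drifted]

/-- The image is the intensity built from the translated field, which has the same variogram. -/
lemma map_translate_functionIntensity_space (h : E d) :
    (functionIntensity P W).map (BrownResnick.translate h 0) = functionIntensity P W := by
  conv_rhs => rw [hW.functionIntensity_eq (hW.translate h)]
  rw [functionIntensity, functionIntensity, Measure.map_map (measurable_translate h 0)
    hW.measurable_translate_driftedMap]
  congr 1
  ext p t
  simp [hW.driftedMap_translate]

lemma lintegral_functionIntensity {φ : C(E d, ℝ) → ℝ≥0∞} (hφ : Measurable φ) :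
    ∫⁻ f, φ f ∂(functionIntensity P W) =
      ∫⁻ ω, ∫⁻ x, φ (BrownResnick.translate 0 x (driftedMap P W ω)) ∂expIntensity ∂P := by
  have := hW.isProbabilityMeasure
  rw [functionIntensity, lintegral_map hφ hW.measurable_translate_driftedMap,
    lintegral_prod_symm (fun p : ℝ × Ω => φ (BrownResnick.translate 0 p.1 (driftedMap P W p.2)))
      (hφ.comp hW.measurable_translate_driftedMap).aemeasurable]

lemma lintegral_functionIntensity_translate {φ : C(E d, ℝ) → ℝ≥0∞} (hφ : Measurable φ)
    (h : E d) (c : ℝ) :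
    ∫⁻ f, φ (BrownResnick.translate h c f) ∂(functionIntensity P W) =
      ENNReal.ofReal (Real.exp c) * ∫⁻ f, φ f ∂(functionIntensity P W) := by
  have hm := measurable_translate (d := d)
  have h1 : ∫⁻ f, φ (BrownResnick.translate h c f) ∂(functionIntensity P W) =
      ∫⁻ f, φ (BrownResnick.translate 0 c f) ∂(functionIntensity P W) := by
    conv_rhs => rw [← hW.map_translate_functionIntensity_space h,
      lintegral_map (f := fun f => φ (BrownResnick.translate 0 c f)) (hφ.comp (hm 0 c)) (hm h 0)]
    simp [translate_translate]
  rw [h1, hW.lintegral_functionIntensity (φ := fun f => φ (BrownResnick.translate 0 c f))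
    (hφ.comp (hm 0 c)), hW.lintegral_functionIntensity hφ,
    ← lintegral_const_mul' _ _ ENNReal.ofReal_ne_top]
  refine lintegral_congr fun ω => ?_
  rw [← lintegral_expIntensity_add]
  · simp [translate_translate, add_comm]
  · exact hφ.comp (measurable_translate_uncurry.comp
      (measurable_const.prodMk (measurable_id.prodMk measurable_const)))

end IsGaussianFieldWithVariogram

/-! ### Suprema over compact sets -/

/-- By continuity, exceeding a level somewhere on `K` is already witnessed on a countable dense
subset, independently of `f`. -/
lemma exists_seq_dense {K : Set (E d)} (hK : K.Nonempty) :
    ∃ u : ℕ → E d, (∀ n, u n ∈ K) ∧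
      ∀ (f : C(E d, ℝ)) (c : ℝ), (∃ t ∈ K, c < f t) ↔ ∃ n, c < f (u n) := by
  have : Nonempty K := hK.to_subtype
  refine ⟨fun n => TopologicalSpace.denseSeq K n, fun n => Subtype.coe_prop _, fun f c => ?_⟩
  constructor
  · rintro ⟨t, ht, h⟩
    have hopen : IsOpen {s : K | c < f s} :=
      isOpen_lt continuous_const (f.continuous.comp continuous_subtype_val)
    exact (TopologicalSpace.denseRange_denseSeq K).exists_mem_open hopen ⟨⟨t, ht⟩, h⟩
  · rintro ⟨n, h⟩
    exact ⟨_, Subtype.coe_prop _, h⟩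

lemma measurableSet_exists_gt (K : Set (E d)) (c : ℝ) :
    MeasurableSet {f : C(E d, ℝ) | ∃ t ∈ K, c < f t} := by
  rcases K.eq_empty_or_nonempty with rfl | hK
  · simp
  obtain ⟨u, -, hu⟩ := exists_seq_dense hK
  simp_rw [hu, ofPred_exists]
  exact MeasurableSet.iUnion fun n => measurableSet_lt measurable_const (measurable_eval _)

/-- The constant in Fernique's theorem for the quantile `3 / 4`. -/
def ferniqueBound : ℝ≥0∞ :=
  .ofReal (Real.exp (Fernique.logRatio (3 / 4))) +
    ∑' n : ℕ, .ofReal (Real.exp (-2⁻¹ * Real.log ((3 / 4 : ℝ≥0∞) / (1 - 3 / 4)).toReal * 2 ^ n))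

lemma half_lt_three_quarters : (2⁻¹ : ℝ≥0∞) < 3 / 4 := by
  rw [ENNReal.lt_div_iff_mul_lt (by simp) (by simp)]
  have : (2⁻¹ : ℝ≥0∞) * 4 = 2 := by
    rw [show (4 : ℝ≥0∞) = 2 * 2 by norm_num, ← mul_assoc,
      ENNReal.inv_mul_cancel (by simp) (by simp),
      one_mul]
  rw [this]
  norm_num

lemma three_quarters_lt_one : (3 / 4 : ℝ≥0∞) < 1 := by
  rw [ENNReal.div_lt_iff (by simp) (by simp)]
  norm_num

lemma ferniqueBound_lt_top : ferniqueBound < ∞ := by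
  refine ENNReal.add_lt_top.mpr ⟨ENNReal.ofReal_lt_top, ?_⟩
  refine Summable.tsum_ofReal_lt_top <|
    Real.summable_exp_nat_mul_of_ge ?_ (fun i ↦ mod_cast (Nat.lt_pow_self (by simp)).le)
  refine mul_neg_of_neg_of_pos (by simp) (Real.log_pos ?_)
  have h1 : ((1 : ℝ≥0∞) - 3 / 4).toReal = 1 / 4 := by
    rw [ENNReal.toReal_sub_of_le three_quarters_lt_one.le (by simp)]
    norm_num
  rw [ENNReal.toReal_div, h1]
  norm_num

/-! ### Local finiteness of the intensity measure -/

namespace IsGaussianFieldWithVariogram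

variable {Ω : Type*} [MeasurableSpace Ω] {P : Measure Ω} {W : Ω → C(E d, ℝ)} {γ : E d → ℝ}
variable (hW : IsGaussianFieldWithVariogram P W γ)
include hW

lemma measurable_restrict (I : Finset (E d)) : Measurable (fun ω (i : I) => W ω i) :=
  measurable_pi_iff.2 fun i => hW.measurable_eval i

/-- Fernique's theorem for a centred Gaussian vector, whose product law is rotation invariant. The
bound does not depend on `I` once the quantile level `a` is fixed. -/
lemma lintegral_exp_sq_norm_restrict_le (I : Finset (E d)) {a : ℝ}
    (ha : 3 / 4 ≤ P {ω | ‖fun i : I => W ω i‖ ≤ a}) :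
    ∫⁻ ω, .ofReal (Real.exp (Fernique.logRatio (3 / 4) * a⁻¹ ^ 2 * ‖fun i : I => W ω i‖ ^ 2)) ∂P ≤
      ferniqueBound := by
  classical
  have hG := (hW.gaussian.hasGaussianLaw I).isGaussian_map
  have hm := hW.measurable_restrict I
  have hP := hW.isProbabilityMeasure
  change IsGaussian (P.map fun ω (i : I) => W ω i) at hG
  have hrot := IsGaussian.map_rotation_eq_self_of_forall_strongDual_eq_zero
    (μ := P.map fun ω (i : I) => W ω i) (by
      intro L
      rw [integral_map hm.aemeasurable (by fun_prop)]
      rw [integral_congr_ae (ae_of_all _ fun ω => strongDual_pi_apply L _)]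
      exact hW.integral_sum (fun i : I => (i : E d)) _) (-(Real.pi / 4))
  have := lintegral_exp_mul_sq_norm_le_of_map_rotation_eq_self hrot (a := a) (c := 3 / 4)
    (by rwa [Measure.map_apply hm (measurableSet_le measurable_norm measurable_const)])
    half_lt_three_quarters
  rwa [lintegral_map (by fun_prop) hm] at this

/-- Exponential moments of the field over finite subsets of a compact set are uniformly bounded. -/
lemma exists_lintegral_exp_norm_restrict_le {K : Set (E d)} (hK : IsCompact K) :
    ∃ B : ℝ≥0∞, B ≠ ∞ ∧ ∀ I : Finset (E d), (I : Set (E d)) ⊆ K →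
      ∫⁻ ω, .ofReal (Real.exp ‖fun i : I => W ω i‖) ∂P ≤ B := by
  have hP := hW.isProbabilityMeasure
  -- Paths are bounded on `K`, so one level `k` bounds `|W|` on all of `K` with probability above `3
  -- / 4`; it serves every finite subset at once.
  have hmono : Monotone fun k : ℕ => {ω | ∀ t ∈ K, |W ω t| ≤ k} := by
    intro k l hkl ω hω t ht
    exact (hω t ht).trans (by exact_mod_cast hkl)
  have hunion : ⋃ k : ℕ, {ω | ∀ t ∈ K, |W ω t| ≤ k} = univ := by
    refine eq_univ_of_forall fun ω => ?_
    obtain ⟨C, hC⟩ := hK.exists_bound_of_continuousOn (W ω).continuous.continuousOn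
    obtain ⟨k, hk⟩ := exists_nat_ge C
    exact mem_iUnion.2 ⟨k, fun t ht => (hC t ht).trans hk⟩
  have htend := tendsto_measure_iUnion_atTop (μ := P) hmono
  rw [hunion, measure_univ] at htend
  obtain ⟨k, hk1, hk⟩ := ((eventually_ge_atTop 1).and
    (htend.eventually (lt_mem_nhds three_quarters_lt_one))).exists
  have hkpos : (0 : ℝ) < k := by exact_mod_cast hk1
  set κ : ℝ := Fernique.logRatio (3 / 4) * (k : ℝ)⁻¹ ^ 2 with hκ
  have hκpos : 0 < κ :=
    mul_pos (Fernique.logRatio_pos half_lt_three_quarters three_quarters_lt_one) (by positivity)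
  -- Completing the square gives `r ≤ κ r² + 1 / (4 κ)`.
  refine ⟨.ofReal (Real.exp (1 / (4 * κ))) * ferniqueBound,
    ENNReal.mul_ne_top ENNReal.ofReal_ne_top ferniqueBound_lt_top.ne, fun I hI => ?_⟩
  have h1 := hW.lintegral_exp_sq_norm_restrict_le I (a := k) (hk.le.trans (measure_mono ?_))
  · refine le_trans ?_ (mul_le_mul_right h1 _)
    rw [← lintegral_const_mul' _ _ ENNReal.ofReal_ne_top]
    refine lintegral_mono fun ω => ?_
    rw [← ENNReal.ofReal_mul (Real.exp_pos _).le, ← Real.exp_add]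
    refine ENNReal.ofReal_le_ofReal (Real.exp_le_exp.2 ?_)
    rw [← hκ]
    set r := ‖fun i : I => W ω i‖
    have : 1 / (4 * κ) + κ * r ^ 2 - r = κ * (r - 1 / (2 * κ)) ^ 2 := by
      field_simp
      ring
    nlinarith [mul_nonneg hκpos.le (sq_nonneg (r - 1 / (2 * κ)))]
  · intro ω hω
    refine (pi_norm_le_iff_of_nonneg hkpos.le).2 fun i => hω i (hI i.2)

/-- Since `ξ ≤ W`, exceeding `c` on `I` forces `x > c - ‖W‖`, a half-line of mass `e^{-c + ‖W‖}`. -/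
lemma functionIntensity_exists_gt_finset_le (I : Finset (E d)) (c : ℝ) :
    functionIntensity P W {f | ∃ t ∈ (I : Set (E d)), c < f t} ≤
      .ofReal (Real.exp (-c)) * ∫⁻ ω, .ofReal (Real.exp ‖fun i : I => W ω i‖) ∂P := by
  rw [← lintegral_indicator_one (measurableSet_exists_gt _ _), hW.lintegral_functionIntensity
    (measurable_one.indicator (measurableSet_exists_gt _ _)),
    ← lintegral_const_mul' _ _ ENNReal.ofReal_ne_top]
  refine lintegral_mono fun ω => ?_
  rw [← ENNReal.ofReal_mul (Real.exp_pos _).le, ← Real.exp_add]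
  have : -c + ‖fun i : I => W ω i‖ = -(c - ‖fun i : I => W ω i‖) := by ring
  rw [this, ← expIntensity_Ioi, ← lintegral_indicator_one measurableSet_Ioi]
  refine lintegral_mono fun x => ?_
  by_cases hx : BrownResnick.translate 0 x (driftedMap P W ω) ∈
      {f : C(E d, ℝ) | ∃ t ∈ (I : Set (E d)), c < f t}
  · obtain ⟨t, ht, h⟩ := hx
    refine le_trans (indicator_le_self' (fun _ _ => zero_le_one) _) ?_
    rw [indicator_of_mem]
    · rfl
    have h1 : driftedMap P W ω t ≤ W ω t := by
      rw [hW.driftedMap_apply, drifted]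
      linarith [variance_nonneg (fun ω' => W ω' t) P]
    have h2 : W ω t ≤ ‖fun i : I => W ω i‖ :=
      (le_abs_self _).trans (norm_le_pi_norm (fun i : I => W ω i) ⟨t, ht⟩)
    simp only [translate_apply, add_zero] at h
    rw [mem_Ioi]
    linarith
  · rw [indicator_of_notMem hx]
    exact zero_le

/-- The expected number of functions exceeding a level on a compact set is finite. -/
lemma functionIntensity_exists_gt_lt_top {K : Set (E d)} (hK : IsCompact K) (c : ℝ) :
    functionIntensity P W {f | ∃ t ∈ K, c < f t} < ∞ := by
  classical
  rcases K.eq_empty_or_nonempty with rfl | hne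
  · simp
  obtain ⟨B, hB, hBI⟩ := hW.exists_lintegral_exp_norm_restrict_le hK
  obtain ⟨u, huK, hu⟩ := exists_seq_dense hne
  have hset : {f : C(E d, ℝ) | ∃ t ∈ K, c < f t} =
      ⋃ m : ℕ, {f | ∃ t ∈ (((Finset.range m).image u : Finset (E d)) : Set (E d)), c < f t} := by
    ext f
    simp only [mem_ofPred_eq, hu, mem_iUnion, Finset.coe_image, Finset.coe_range,
      exists_mem_image, mem_Iio]
    exact ⟨fun ⟨n, hn⟩ => ⟨n + 1, n, n.lt_succ_self, hn⟩, fun ⟨_, n, _, hn⟩ => ⟨n, hn⟩⟩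
  have hmono : Monotone fun m : ℕ => {f : C(E d, ℝ) |
      ∃ t ∈ (((Finset.range m).image u : Finset (E d)) : Set (E d)), c < f t} := by
    rintro m n hmn f ⟨t, ht, h⟩
    refine ⟨t, ?_, h⟩
    exact Finset.image_subset_image (Finset.range_mono hmn) ht
  rw [hset, hmono.measure_iUnion]
  refine lt_of_le_of_lt (iSup_le fun m => (hW.functionIntensity_exists_gt_finset_le _ c).trans
    (mul_le_mul_right (hBI _ ?_) _)) (ENNReal.mul_lt_top ENNReal.ofReal_lt_top hB.lt_top)
  rw [Finset.coe_image]
  rintro _ ⟨n, -, rfl⟩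
  exact huK n

end IsGaussianFieldWithVariogram

/-! ### The peak of a function tending to `-∞` -/

/-- The functions on `ℝᵈ` tending to `-∞` at infinity. -/
def coerciveSet (d : ℕ) : Set C(E d, ℝ) := {f | Tendsto f (cocompact (E d)) atBot}

/-- The set of maximizers. -/
def argmax (f : E d → ℝ) : Set (E d) := {t | ∀ s, f s ≤ f t}

lemma argmax_nonempty {f : C(E d, ℝ)} (hf : f ∈ coerciveSet d) : (argmax f).Nonempty :=
  f.continuous.exists_forall_ge hf

lemma isCompact_superlevel {f : C(E d, ℝ)} (hf : f ∈ coerciveSet d) (c : ℝ) :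
    IsCompact {t | c ≤ f t} := by
  have h : ∀ᶠ t in cocompact (E d), f t < c := hf.eventually (eventually_lt_atBot c)
  obtain ⟨K, hK, hKc⟩ := mem_cocompact.1 h
  refine hK.of_isClosed_subset (isClosed_le continuous_const f.continuous) fun t ht => ?_
  by_contra hn
  have : f t < c := hKc hn
  exact absurd this (not_lt.2 ht)

lemma isCompact_argmax {f : C(E d, ℝ)} (hf : f ∈ coerciveSet d) : IsCompact (argmax f) := by
  obtain ⟨t₀, ht₀⟩ := argmax_nonempty hf
  have : argmax f = {t | f t₀ ≤ f t} := by
    ext t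
    exact ⟨fun h => h t₀, fun h s => (ht₀ s).trans h⟩
  rw [this]
  exact isCompact_superlevel hf _

lemma isGreatest_peakValue {f : C(E d, ℝ)} (hf : f ∈ coerciveSet d) :
    IsGreatest (range f) (peakValue f) := by
  obtain ⟨t, ht⟩ := argmax_nonempty hf
  have h : IsGreatest (range f) (f t) := ⟨mem_range_self t, by rintro _ ⟨s, rfl⟩; exact ht s⟩
  rwa [peakValue, iSup, h.csSup_eq]

lemma peakValue_eq_of_mem_argmax {f : C(E d, ℝ)} (hf : f ∈ coerciveSet d) {t : E d}
    (ht : t ∈ argmax f) : f t = peakValue f :=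
  (IsGreatest.unique ⟨mem_range_self t, by rintro _ ⟨s, rfl⟩; exact ht s⟩
    (isGreatest_peakValue hf))

/-- Each coordinate infimum is attained by compactness, but possibly at different maximizers: the
peak location itself need not be a maximizer. -/
lemma isLeast_peakLocation {f : C(E d, ℝ)} (hf : f ∈ coerciveSet d) (k : Fin d) :
    IsLeast ((fun t : E d => t k) '' argmax f) (peakLocation f k) :=
  ((isCompact_argmax hf).image (by fun_prop)).isLeast_sInf ((argmax_nonempty hf).image _)

lemma translate_mem_coerciveSet {f : C(E d, ℝ)} (hf : f ∈ coerciveSet d) (h : E d) (c : ℝ) :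
    translate h c f ∈ coerciveSet d :=
  tendsto_atBot_add_const_right _ c
    (Tendsto.comp hf (Homeomorph.addRight h).isClosedEmbedding.tendsto_cocompact)

lemma mem_argmax_translate {f : C(E d, ℝ)} {h : E d} {c : ℝ} {t : E d} :
    t ∈ argmax (translate h c f) ↔ t + h ∈ argmax f := by
  simp only [argmax, mem_ofPred_eq, translate_apply, add_le_add_iff_right]
  exact ⟨fun H s => by simpa using H (s - h), fun H s => H _⟩

lemma peakValue_translate {f : C(E d, ℝ)} (hf : f ∈ coerciveSet d) (h : E d) (c : ℝ) :
    peakValue (translate h c f) = peakValue f + c := by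
  obtain ⟨t, ht⟩ := argmax_nonempty hf
  rw [← peakValue_eq_of_mem_argmax hf ht, ← peakValue_eq_of_mem_argmax
    (translate_mem_coerciveSet hf h c) (t := t - h) (mem_argmax_translate.2 (by simpa using ht))]
  simp

lemma peakLocation_translate {f : C(E d, ℝ)} (hf : f ∈ coerciveSet d) (h : E d) (c : ℝ) :
    peakLocation (translate h c f) = peakLocation f - h := by
  ext k
  refine (isLeast_peakLocation (translate_mem_coerciveSet hf h c) k).unique ?_
  obtain ⟨⟨t, ht, hk⟩, hle⟩ := isLeast_peakLocation hf k
  refine ⟨⟨t - h, mem_argmax_translate.2 (by simpa using ht), ?_⟩, ?_⟩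
  · simpa using hk
  · rintro _ ⟨s, hs, rfl⟩
    have := hle ⟨s + h, mem_argmax_translate.1 hs, rfl⟩
    simp only [PiLp.add_apply] at this
    simp only [PiLp.sub_apply]
    linarith

lemma peakShape_eq_translate (f : C(E d, ℝ)) :
    peakShape f = translate (peakLocation f) (-peakValue f) f := by
  ext t
  rw [peakShape, toContinuousMap_apply (by fun_prop), translate_apply, sub_eq_add_neg]

/-- The location, the value and the shape of the peak of a function. -/
def peak (f : C(E d, ℝ)) : E d × ℝ × C(E d, ℝ) := (peakLocation f, peakValue f, peakShape f)

/-- Equivariance: shifts move location and height and leave the shape alone, which lets symmetries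
of the function intensity pass to `Ψ`. -/
lemma peak_translate {f : C(E d, ℝ)} (hf : f ∈ coerciveSet d) (h : E d) (c : ℝ) :
    peak (translate h c f) = ((peak f).1 - h, (peak f).2.1 + c, (peak f).2.2) := by
  simp only [peak, peakShape_eq_translate, peakLocation_translate hf, peakValue_translate hf,
    translate_translate]
  rw [sub_add_cancel, neg_add, neg_add_cancel_right]

lemma translate_peak (f : C(E d, ℝ)) :
    translate (-(peak f).1) (peak f).2.1 (peak f).2.2 = f := by
  simp [peak, peakShape_eq_translate, translate_translate]

/-! ### Measurability of the peak -/

lemma tendsto_cocompact_atBot_iff (f : C(E d, ℝ)) :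
    f ∈ coerciveSet d ↔ ∀ n : ℕ, ∃ R : ℕ, ∀ j : ℕ, (R : ℝ) < ‖TopologicalSpace.denseSeq (E d) j‖ →
      f (TopologicalSpace.denseSeq (E d) j) ≤ -(n : ℝ) := by
  constructor
  · intro hf n
    have h : ∀ᶠ t in cocompact (E d), f t ≤ -(n : ℝ) := hf.eventually (eventually_le_atBot _)
    obtain ⟨K, hK, hKc⟩ := mem_cocompact.1 h
    obtain ⟨C, hC⟩ := hK.isBounded.exists_norm_le
    obtain ⟨R, hR⟩ := exists_nat_ge C
    refine ⟨R, fun j hj => hKc fun hmem => ?_⟩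
    linarith [hC _ hmem]
  · intro H
    refine tendsto_atBot.2 fun b => ?_
    obtain ⟨n, hn⟩ := exists_nat_ge (-b)
    obtain ⟨R, hR⟩ := H n
    have hcl : ∀ t : E d, (R : ℝ) < ‖t‖ → f t ≤ -(n : ℝ) := by
      intro t ht
      by_contra! hlt
      have hopen : IsOpen {s : E d | (R : ℝ) < ‖s‖ ∧ -(n : ℝ) < f s} :=
        (isOpen_lt continuous_const continuous_norm).inter
          (isOpen_lt continuous_const f.continuous)
      obtain ⟨j, hj⟩ := (TopologicalSpace.denseRange_denseSeq (E d)).exists_mem_open hopen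
        ⟨t, ht, hlt⟩
      linarith [hR j hj.1, hj.2]
    refine mem_of_superset ((isCompact_closedBall (0 : E d) R).compl_mem_cocompact) fun t ht => ?_
    have : (R : ℝ) < ‖t‖ := by simpa using ht
    exact (hcl t this).trans (by linarith)

lemma measurableSet_coerciveSet : MeasurableSet (coerciveSet d) := by
  have : coerciveSet d = {f : C(E d, ℝ) | ∀ n : ℕ, ∃ R : ℕ, ∀ j : ℕ,
      (R : ℝ) < ‖TopologicalSpace.denseSeq (E d) j‖ →
      f (TopologicalSpace.denseSeq (E d) j) ≤ -(n : ℝ)} :=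
    ext tendsto_cocompact_atBot_iff
  rw [this]
  simp_rw [ofPred_forall, ofPred_exists, ofPred_forall]
  exact MeasurableSet.iInter fun n => MeasurableSet.iUnion fun R => MeasurableSet.iInter fun j =>
    MeasurableSet.iInter fun _ => measurableSet_le (measurable_eval _) measurable_const

/-- A countable criterion for measurability. Near-maximizers in `U` accumulate at a maximizer by
compactness, but the limit is only known to lie in the closure. -/
lemma exists_argmax_mem_closure_iff {f : C(E d, ℝ)} (hf : f ∈ coerciveSet d) {U : Set (E d)}
    (hU : IsOpen U) :
    (∃ t ∈ closure U, t ∈ argmax f) ↔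
      ∀ n : ℕ, ∃ i : ℕ, TopologicalSpace.denseSeq (E d) i ∈ U ∧
        ∀ j : ℕ, f (TopologicalSpace.denseSeq (E d) j) - 1 / ((n : ℝ) + 1) <
          f (TopologicalSpace.denseSeq (E d) i) := by
  constructor
  · rintro ⟨t, ht, hmax⟩ n
    have hpos : (0 : ℝ) < 1 / ((n : ℝ) + 1) := by positivity
    have hopen : IsOpen {s | f t - 1 / ((n : ℝ) + 1) < f s} :=
      isOpen_lt continuous_const f.continuous
    obtain ⟨s, hs, hsU⟩ := mem_closure_iff.1 ht _ hopen (by simpa using hpos)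
    obtain ⟨i, hi⟩ := (TopologicalSpace.denseRange_denseSeq (E d)).exists_mem_open
      (hopen.inter hU) ⟨s, hs, hsU⟩
    exact ⟨i, hi.2, fun j => lt_of_le_of_lt (sub_le_sub_right (hmax _) _) hi.1⟩
  · intro H
    choose i hiU hi using H
    have hle : ∀ (n : ℕ) s,
        f s - 1 / ((n : ℝ) + 1) ≤ f (TopologicalSpace.denseSeq (E d) (i n)) := by
      intro n s
      have hcl : IsClosed {s | f s - 1 / ((n : ℝ) + 1) ≤
          f (TopologicalSpace.denseSeq (E d) (i n))} :=
        isClosed_le (f.continuous.sub continuous_const) continuous_const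
      have hd := (TopologicalSpace.denseRange_denseSeq (E d)).closure_range
      have hsub : range (TopologicalSpace.denseSeq (E d)) ⊆ {s | f s - 1 / ((n : ℝ) + 1) ≤
          f (TopologicalSpace.denseSeq (E d) (i n))} := by
        rintro _ ⟨j, rfl⟩
        exact (hi n j).le
      exact hcl.closure_subset_iff.2 hsub (hd ▸ mem_univ s)
    obtain ⟨t₀, ht₀⟩ := argmax_nonempty hf
    -- All errors `1 / (n + 1)` are at most `1`, so the near-maximizers stay in one compact
    -- superlevel set.
    have hmem : ∀ n, TopologicalSpace.denseSeq (E d) (i n) ∈ {t | f t₀ - 1 ≤ f t} := by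
      intro n
      have h1 : 1 / ((n : ℝ) + 1) ≤ 1 := by
        rw [div_le_one (by positivity)]
        linarith [(Nat.cast_nonneg n : (0 : ℝ) ≤ n)]
      have := hle n t₀
      rw [mem_ofPred_eq]
      linarith
    obtain ⟨t, -, φ, hφ, hlim⟩ := (isCompact_superlevel hf (f t₀ - 1)).tendsto_subseq hmem
    refine ⟨t, mem_closure_of_tendsto hlim (Eventually.of_forall fun n => hiU _), fun s => ?_⟩
    have h1 : Tendsto (fun n => f s - 1 / ((φ n : ℝ) + 1)) atTop (𝓝 (f s - 0)) :=
      tendsto_const_nhds.sub (tendsto_one_div_add_atTop_nhds_zero_nat.comp hφ.tendsto_atTop)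
    rw [sub_zero] at h1
    exact le_of_tendsto_of_tendsto' h1 ((f.continuous.tendsto t).comp hlim) fun n => hle (φ n) s

lemma measurableSet_exists_argmax_mem_closure {U : Set (E d)} (hU : IsOpen U) :
    MeasurableSet {f : C(E d, ℝ) | f ∈ coerciveSet d ∧ ∃ t ∈ closure U, t ∈ argmax f} := by
  have : {f : C(E d, ℝ) | f ∈ coerciveSet d ∧ ∃ t ∈ closure U, t ∈ argmax f} =
      coerciveSet d ∩ {f : C(E d, ℝ) | ∀ n : ℕ, ∃ i : ℕ, TopologicalSpace.denseSeq (E d) i ∈ U ∧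
        ∀ j : ℕ, f (TopologicalSpace.denseSeq (E d) j) - 1 / ((n : ℝ) + 1) <
          f (TopologicalSpace.denseSeq (E d) i)} := by
    ext f
    exact and_congr_right fun hf => exists_argmax_mem_closure_iff hf hU
  rw [this]
  refine measurableSet_coerciveSet.inter ?_
  simp_rw [ofPred_forall, ofPred_exists, ofPred_and, ofPred_forall]
  exact MeasurableSet.iInter fun n => MeasurableSet.iUnion fun i =>
    (MeasurableSet.const _).inter (MeasurableSet.iInter fun j =>
      measurableSet_lt ((measurable_eval _).sub_const _) (measurable_eval _))

lemma closure_coord_lt (k : Fin d) (a : ℝ) :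
    closure {t : E d | t k < a} = {t : E d | t k ≤ a} := by
  have hopen : IsOpenMap (fun t : E d => t k) :=
    (EuclideanSpace.proj (𝕜 := ℝ) k).isOpenMap fun x => ⟨EuclideanSpace.single k x, by simp⟩
  have h := hopen.preimage_closure_eq_closure_preimage (by fun_prop) (Iio a)
  rw [closure_Iio] at h
  exact h.symm

open Classical in
/-- The location of the peak, with value `0` if the function does not tend to `-∞`. -/
def peakLocation₀ (f : C(E d, ℝ)) : E d := if f ∈ coerciveSet d then peakLocation f else 0

lemma peakLocation₀_eq {f : C(E d, ℝ)} (hf : f ∈ coerciveSet d) :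
    peakLocation₀ f = peakLocation f := if_pos hf

lemma measurable_peakLocation₀ : Measurable (peakLocation₀ (d := d)) := by
  have h : ∀ k, Measurable (fun f => peakLocation₀ (d := d) f k) := by
    intro k
    refine measurable_of_Iic fun a => ?_
    -- The least `k`-th coordinate is attained, so it is at most `a` exactly when some maximizer
    -- lies in the half-space `t k ≤ a`, the closure of an open one. The second set accounts for the
    -- default value `0`.
    have : (fun f => peakLocation₀ (d := d) f k) ⁻¹' Iic a =
        {f : C(E d, ℝ) | f ∈ coerciveSet d ∧ ∃ t ∈ closure {t : E d | t k < a}, t ∈ argmax f} ∪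
          ((coerciveSet d)ᶜ ∩ {_f | (0 : ℝ) ≤ a}) := by
      ext f
      by_cases hf : f ∈ coerciveSet d
      · simp only [mem_preimage, mem_Iic, peakLocation₀_eq hf, closure_coord_lt, mem_union,
          mem_ofPred_eq, hf, true_and, mem_inter_iff, mem_compl_iff, not_true_eq_false, false_and,
          or_false]
        obtain ⟨⟨t, ht, hk⟩, hle⟩ := isLeast_peakLocation hf k
        exact ⟨fun h => ⟨t, hk.trans_le h, ht⟩, fun ⟨s, hs, hmax⟩ => (hle ⟨s, hmax, rfl⟩).trans hs⟩
      · simp [peakLocation₀, hf]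
    rw [this]
    exact (measurableSet_exists_argmax_mem_closure (isOpen_lt (by fun_prop) continuous_const)).union
      (measurableSet_coerciveSet.compl.inter (MeasurableSet.const _))
  exact (MeasurableEquiv.toLp 2 (Fin d → ℝ)).measurable.comp (measurable_pi_iff.2 h)

lemma peakValue_eq_iSup_denseSeq (f : C(E d, ℝ)) :
    peakValue f = ⨆ j : ℕ, f (TopologicalSpace.denseSeq (E d) j) := by
  rw [peakValue, ← Dense.ciSup' (TopologicalSpace.denseRange_denseSeq (E d)) f.continuous, iSup,
    iSup]
  congr 1
  ext y
  simp

lemma measurable_peakValue : Measurable (fun f : C(E d, ℝ) => peakValue f) := by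
  simp_rw [peakValue_eq_iSup_denseSeq]
  exact Measurable.iSup fun j => measurable_eval _

/-- A measurable version of the peak. -/
def peak₀ (f : C(E d, ℝ)) : E d × ℝ × C(E d, ℝ) :=
  (peakLocation₀ f, peakValue f, translate (peakLocation₀ f) (-peakValue f) f)

lemma peak₀_eq {f : C(E d, ℝ)} (hf : f ∈ coerciveSet d) : peak₀ f = peak f := by
  rw [peak₀, peak, peakLocation₀_eq hf, peakShape_eq_translate]

lemma measurable_peak₀ : Measurable (peak₀ (d := d)) :=
  measurable_peakLocation₀.prodMk (measurable_peakValue.prodMk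
    (measurable_translate_uncurry.comp (measurable_peakLocation₀.prodMk
      (measurable_peakValue.neg.prodMk measurable_id))))

/-! ### The unit cube -/

lemma volume_unitCube :
    (volume : Measure (E d)) {t | ∀ k, t k ∈ Icc (0 : ℝ) 1} = 1 := by
  have h := (EuclideanSpace.volume_preserving_symm_measurableEquiv_toLp (Fin d)).measure_preimage
    (s := Icc (0 : Fin d → ℝ) 1) measurableSet_Icc.nullMeasurableSet
  rw [Real.volume_Icc_pi] at h
  simp only [Pi.one_apply, Pi.zero_apply, sub_zero, ENNReal.ofReal_one, Finset.prod_const_one] at h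
  rw [← h]
  congr 1
  ext t
  simp [Pi.le_def, forall_and]

lemma isClosed_unitCube : IsClosed {t : E d | ∀ k, t k ∈ Icc (0 : ℝ) 1} := by
  rw [ofPred_forall]
  exact isClosed_iInter fun k => isClosed_Icc.preimage (by fun_prop)

lemma isCompact_unitCube : IsCompact {t : E d | ∀ k, t k ∈ Icc (0 : ℝ) 1} := by
  have h : IsCompact ((WithLp.toLp 2 : (Fin d → ℝ) → E d) '' Icc 0 1) :=
    isCompact_Icc.image (PiLp.continuous_toLp 2 _)
  refine h.of_isClosed_subset isClosed_unitCube fun t ht => ⟨fun k => t k, ?_, rfl⟩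
  exact ⟨fun k => (ht k).1, fun k => (ht k).2⟩

lemma isOpen_openUnitCube : IsOpen {t : E d | ∀ k, t k ∈ Ioo (0 : ℝ) 1} := by
  rw [ofPred_forall]
  exact isOpen_iInter_of_finite fun k => isOpen_Ioo.preimage (by fun_prop)

/-! ### The intensity of peaks: equivariance and finiteness -/

section Peak

variable {Ω : Type*} [MeasurableSpace Ω] {P : Measure Ω} {W : Ω → C(E d, ℝ)} {γ : E d → ℝ}

namespace IsGaussianFieldWithVariogram

variable (hW : IsGaussianFieldWithVariogram P W γ)
include hW

lemma ae_mem_coerciveSet (hlim : ∀ᵐ ω ∂P, Tendsto (drifted P W ω) (cocompact (E d)) atBot) :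
    ∀ᵐ f ∂(functionIntensity P W), f ∈ coerciveSet d := by
  have := hW.isProbabilityMeasure
  rw [functionIntensity]
  refine (ae_map_iff hW.measurable_translate_driftedMap.aemeasurable
    (p := fun f => f ∈ coerciveSet d) measurableSet_coerciveSet).2 ?_
  filter_upwards [Measure.quasiMeasurePreserving_snd.ae hlim] with p hp
  refine translate_mem_coerciveSet ?_ 0 p.1
  rw [coerciveSet, mem_ofPred_eq]
  simpa only [funext (hW.driftedMap_apply p.2)] using hp

variable (hlim : ∀ᵐ ω ∂P, Tendsto (drifted P W ω) (cocompact (E d)) atBot)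
include hlim

/-- By equivariance the peak of `x + ξ` is `(T, x + M, F)`; the measurable version `peak₀` agrees
with it almost everywhere. -/
lemma peakIntensity_eq_map : peakIntensity P W = (functionIntensity P W).map peak₀ := by
  have := hW.isProbabilityMeasure
  rw [functionIntensity, Measure.map_map measurable_peak₀ hW.measurable_translate_driftedMap,
    peakIntensity]
  refine Measure.map_congr ?_
  filter_upwards [Measure.quasiMeasurePreserving_snd.ae hlim] with p hp
  have hco : driftedMap P W p.2 ∈ coerciveSet d := by
    rw [coerciveSet, mem_ofPred_eq]
    simpa only [funext (hW.driftedMap_apply p.2)] using hp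
  rw [Function.comp_apply, peak₀_eq (translate_mem_coerciveSet hco _ _), peak_translate hco]
  simp only [peak, sub_zero]
  rw [show drifted P W p.2 = driftedMap P W p.2 from
    (funext (hW.driftedMap_apply p.2)).symm, add_comm]

lemma functionIntensity_eq_map_peakIntensity : functionIntensity P W =
    (peakIntensity P W).map (fun p => BrownResnick.translate (-p.1) p.2.1 p.2.2) := by
  have hm : Measurable (fun p : E d × ℝ × C(E d, ℝ) =>
      BrownResnick.translate (-p.1) p.2.1 p.2.2) :=
    measurable_translate_uncurry.comp (measurable_fst.neg.prodMk measurable_snd)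
  rw [hW.peakIntensity_eq_map hlim, Measure.map_map hm measurable_peak₀]
  conv_lhs => rw [← Measure.map_id (μ := functionIntensity P W)]
  refine Measure.map_congr ?_
  filter_upwards [hW.ae_mem_coerciveSet hlim] with f hf
  rw [Function.comp_apply, peak₀_eq hf, translate_peak, id]

lemma lintegral_peakIntensity_translate {ψ : E d × ℝ × C(E d, ℝ) → ℝ≥0∞} (hψ : Measurable ψ)
    (h : E d) (c : ℝ) :
    ∫⁻ p, ψ (p.1 - h, p.2.1 + c, p.2.2) ∂(peakIntensity P W) =
      ENNReal.ofReal (Real.exp c) * ∫⁻ p, ψ p ∂(peakIntensity P W) := by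
  have hm : Measurable (fun p : E d × ℝ × C(E d, ℝ) => ψ (p.1 - h, p.2.1 + c, p.2.2)) :=
    hψ.comp (by fun_prop)
  rw [hW.peakIntensity_eq_map hlim, lintegral_map hm measurable_peak₀,
    lintegral_map hψ measurable_peak₀, ← hW.lintegral_functionIntensity_translate
      (φ := fun f => ψ (peak₀ f)) (hψ.comp measurable_peak₀) h c]
  refine lintegral_congr_ae ?_
  filter_upwards [hW.ae_mem_coerciveSet hlim] with f hf
  rw [peak₀_eq hf, peak₀_eq (translate_mem_coerciveSet hf _ _),
    peak_translate hf]

/-- A mass transport argument: the expected number of peaks in a bounded box is finite. -/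
lemma peakIntensity_box_lt_top :
    peakIntensity P W {p | (∀ k, p.1 k ∈ Ioo (0 : ℝ) 1) ∧ p.2.1 ∈ Icc (0 : ℝ) 1} < ∞ := by
  set b := (EuclideanSpace.basisFun (Fin d) ℝ).toBasis with hb
  set F := ZSpan.fundamentalDomain b with hF
  have hFm : MeasurableSet F := ZSpan.fundamentalDomain_measurableSet b
  obtain ⟨R, hRpos, hR⟩ := (ZSpan.fundamentalDomain_isBounded b).exists_pos_norm_lt
  -- A peak location in the cell `F` does not by itself place a maximizer in a bounded region. Each
  -- such function is therefore moved by the lattice vector that brings one of its maximizers into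
  -- `F`; translation invariance preserves the mass.
  set H : Set C(E d, ℝ) := {f | f ∈ coerciveSet d ∧
    ∃ t ∈ closure (Metric.ball (0 : E d) R), t ∈ argmax f} with hH
  have hHm : MeasurableSet H := measurableSet_exists_argmax_mem_closure Metric.isOpen_ball
  -- The target for the vector `v`: a maximizer is near the origin while the peak location lies in
  -- the cell `v + F`. These cells are disjoint, so the transported masses add up to at most that of
  -- functions exceeding `-1` on a ball.
  let B : Submodule.span ℤ (range b) → Set C(E d, ℝ) := fun v =>
    {f | f ∈ H ∧ peakValue f ∈ Icc (0 : ℝ) 1 ∧ peakLocation₀ f - v ∈ F}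
  have hBm : ∀ v, MeasurableSet (B v) := fun v =>
    hHm.inter ((measurableSet_Icc.preimage measurable_peakValue).inter
      (hFm.preimage (measurable_peakLocation₀.sub_const _)))
  have hBdisj : Pairwise (Function.onFun Disjoint B) := by
    intro v w hvw
    refine disjoint_left.2 fun f hfv hfw => hvw ?_
    have h1 : (-v) +ᵥ peakLocation₀ f ∈ F := by
      have := hfv.2.2
      rwa [sub_eq_neg_add] at this
    have h2 : (-w) +ᵥ peakLocation₀ f ∈ F := by
      have := hfw.2.2
      rwa [sub_eq_neg_add] at this
    exact neg_injective
      ((ZSpan.exist_unique_vadd_mem_fundamentalDomain b (peakLocation₀ f)).unique h1 h2)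
  have hcov : {f : C(E d, ℝ) | f ∈ coerciveSet d ∧ peakLocation₀ f ∈ F ∧
      peakValue f ∈ Icc (0 : ℝ) 1} ⊆
      ⋃ v : Submodule.span ℤ (range b), BrownResnick.translate (-(v : E d)) 0 ⁻¹' B v := by
    rintro f ⟨hf, hloc, hval⟩
    obtain ⟨t₀, ht₀⟩ := argmax_nonempty hf
    obtain ⟨v, hv, -⟩ := ZSpan.exist_unique_vadd_mem_fundamentalDomain b t₀
    have hg := translate_mem_coerciveSet hf (-(v : E d)) 0
    refine mem_iUnion.2 ⟨v, ⟨hg, (v : E d) + t₀, ?_, ?_⟩, ?_, ?_⟩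
    · exact subset_closure (mem_ball_zero_iff.2 (hR _ hv))
    · rw [mem_argmax_translate]
      simpa using ht₀
    · rwa [peakValue_translate hf, add_zero]
    · rwa [peakLocation₀_eq hg, peakLocation_translate hf, sub_neg_eq_add, add_sub_cancel_right,
        ← peakLocation₀_eq hf]
  have hle : functionIntensity P W {f : C(E d, ℝ) | f ∈ coerciveSet d ∧ peakLocation₀ f ∈ F ∧
      peakValue f ∈ Icc (0 : ℝ) 1} < ∞ := by
    calc _ ≤ ∑' v : Submodule.span ℤ (range b), functionIntensity P W
          (BrownResnick.translate (-(v : E d)) 0 ⁻¹' B v) :=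
          (measure_mono hcov).trans (measure_iUnion_le _)
      _ = ∑' v : Submodule.span ℤ (range b), functionIntensity P W (B v) := by
          refine tsum_congr fun v => ?_
          rw [← Measure.map_apply (measurable_translate _ _) (hBm v),
            hW.map_translate_functionIntensity_space]
      _ = functionIntensity P W (⋃ v, B v) := (measure_iUnion hBdisj hBm).symm
      _ ≤ functionIntensity P W {f | ∃ t ∈ Metric.closedBall (0 : E d) R, (-1 : ℝ) < f t} := by
          refine measure_mono (iUnion_subset fun v f hf => ?_)
          obtain ⟨⟨hfc, t, ht, hmax⟩, hval, -⟩ := hf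
          refine ⟨t, Metric.closure_ball_subset_closedBall ht, ?_⟩
          rw [peakValue_eq_of_mem_argmax hfc hmax]
          linarith [hval.1]
      _ < ∞ := hW.functionIntensity_exists_gt_lt_top (isCompact_closedBall _ _) _
  have hbox : MeasurableSet {p : E d × ℝ × C(E d, ℝ) |
      (∀ k, p.1 k ∈ Ioo (0 : ℝ) 1) ∧ p.2.1 ∈ Icc (0 : ℝ) 1} :=
    (isOpen_openUnitCube.measurableSet.preimage measurable_fst).inter
      (measurableSet_Icc.preimage (measurable_fst.comp measurable_snd))
  rw [hW.peakIntensity_eq_map hlim, Measure.map_apply measurable_peak₀ hbox]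
  refine lt_of_le_of_lt (measure_mono_ae ?_) hle
  filter_upwards [hW.ae_mem_coerciveSet hlim] with f hf hp
  refine ⟨hf, ?_, hp.2⟩
  rw [hF, ZSpan.mem_fundamentalDomain]
  intro k
  simpa [hb, peak₀] using Ioo_subset_Ico_self (hp.1 k)

end IsGaussianFieldWithVariogram

/-! ### The product structure of `Ψ` -/

/-- The measure `e^y Ψ(dt, dy, A)` on `ℝᵈ × ℝ`. -/
def tiltedPeak (P : Measure Ω) (W : Ω → C(E d, ℝ)) (A : Set C(E d, ℝ)) : Measure (E d × ℝ) :=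
  (((peakIntensity P W).restrict {p | p.2.2 ∈ A}).withDensity
    (fun p => ENNReal.ofReal (Real.exp p.2.1))).map (fun p => (p.1, p.2.1))

lemma lintegral_tiltedPeak {A : Set C(E d, ℝ)} (hA : MeasurableSet A) {ψ : E d × ℝ → ℝ≥0∞}
    (hψ : Measurable ψ) : ∫⁻ q, ψ q ∂(tiltedPeak P W A) =
      ∫⁻ p, {p : E d × ℝ × C(E d, ℝ) | p.2.2 ∈ A}.indicator
        (fun p => ENNReal.ofReal (Real.exp p.2.1) * ψ (p.1, p.2.1)) p ∂(peakIntensity P W) := by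
  have hA' : MeasurableSet {p : E d × ℝ × C(E d, ℝ) | p.2.2 ∈ A} :=
    hA.preimage (measurable_snd.comp measurable_snd)
  have hm : Measurable (fun p : E d × ℝ × C(E d, ℝ) => ψ (p.1, p.2.1)) :=
    hψ.comp (by fun_prop)
  rw [tiltedPeak, lintegral_map hψ (by fun_prop),
    lintegral_withDensity_eq_lintegral_mul _ (by fun_prop) hm, lintegral_indicator hA']
  rfl

lemma tiltedPeak_unitCube {A : Set C(E d, ℝ)} (hA : MeasurableSet A) :
    tiltedPeak P W A ({t | ∀ k, t k ∈ Icc (0 : ℝ) 1} ×ˢ Icc 0 1) = shapeMeasure P W A := by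
  have hA' : MeasurableSet {p : E d × ℝ × C(E d, ℝ) | p.2.2 ∈ A} :=
    hA.preimage (measurable_snd.comp measurable_snd)
  have hU : MeasurableSet ({t : E d | ∀ k, t k ∈ Icc (0 : ℝ) 1} ×ˢ Icc (0 : ℝ) 1) :=
    isClosed_unitCube.measurableSet.prod measurableSet_Icc
  have hU' : MeasurableSet ((fun p : E d × ℝ × C(E d, ℝ) => (p.1, p.2.1)) ⁻¹'
      ({t : E d | ∀ k, t k ∈ Icc (0 : ℝ) 1} ×ˢ Icc (0 : ℝ) 1)) :=
    hU.preimage (by fun_prop)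
  rw [tiltedPeak, shapeMeasure, Measure.map_apply (by fun_prop) hU,
    Measure.map_apply (by fun_prop) hA, withDensity_apply _ hU',
    withDensity_apply _ (hA.preimage (by fun_prop)), Measure.restrict_restrict hU',
    Measure.restrict_restrict (hA.preimage (by fun_prop)), inter_comm]
  rfl

namespace IsGaussianFieldWithVariogram

variable (hW : IsGaussianFieldWithVariogram P W γ)
  (hlim : ∀ᵐ ω ∂P, Tendsto (drifted P W ω) (cocompact (E d)) atBot)
include hW hlim

/-- The weight `e^y` compensates the exponential factor that a vertical shift produces in `Ψ`. -/
lemma isAddLeftInvariant_tiltedPeak {A : Set C(E d, ℝ)} (hA : MeasurableSet A) :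
    (tiltedPeak P W A).IsAddLeftInvariant := by
  refine ⟨fun g => ?_⟩
  ext B hB
  have hgB : MeasurableSet ((fun q => g + q) ⁻¹' B) := hB.preimage (measurable_const_add g)
  have hA' : MeasurableSet {p : E d × ℝ × C(E d, ℝ) | p.2.2 ∈ A} :=
    hA.preimage (measurable_snd.comp measurable_snd)
  rw [Measure.map_apply (measurable_const_add g) hB, ← lintegral_indicator_one hB,
    ← lintegral_indicator_one hgB, lintegral_tiltedPeak hA (measurable_one.indicator hB),
    lintegral_tiltedPeak hA (measurable_one.indicator hgB)]
  have hψ : Measurable ({p : E d × ℝ × C(E d, ℝ) | p.2.2 ∈ A}.indicator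
      (fun p => ENNReal.ofReal (Real.exp p.2.1) * B.indicator 1 (p.1, p.2.1))) := by
    refine Measurable.indicator (Measurable.mul (by fun_prop) ?_) hA'
    exact (measurable_one.indicator hB).comp (by fun_prop)
  have key := hW.lintegral_peakIntensity_translate hlim hψ (-g.1) g.2
  have hexp : ENNReal.ofReal (Real.exp g.2) ≠ 0 := by
    simpa using Real.exp_pos g.2
  rw [← ENNReal.mul_right_inj hexp ENNReal.ofReal_ne_top, ← key,
    ← lintegral_const_mul' _ _ ENNReal.ofReal_ne_top]
  refine lintegral_congr fun p => ?_
  by_cases hp : p ∈ {p : E d × ℝ × C(E d, ℝ) | p.2.2 ∈ A}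
  · have hq : (p.1 - -g.1, p.2.1 + g.2, p.2.2) ∈ {p : E d × ℝ × C(E d, ℝ) | p.2.2 ∈ A} := hp
    rw [indicator_of_mem hp, indicator_of_mem hq,
      ← mul_assoc, ← ENNReal.ofReal_mul (Real.exp_pos _).le, ← Real.exp_add, add_comm g.2 p.2.1]
    congr 1
    change B.indicator (1 : E d × ℝ → ℝ≥0∞) (g + (p.1, p.2.1)) = _
    congr 1
    ext1 <;> simp [add_comm]
  · have hq : (p.1 - -g.1, p.2.1 + g.2, p.2.2) ∉ {p : E d × ℝ × C(E d, ℝ) | p.2.2 ∈ A} := hp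
    rw [indicator_of_notMem hp, indicator_of_notMem hq, mul_zero]

/-- An invariant measure that is finite on one nonempty open set is finite on compacts; on the open
unit box the weight is at most `e`. -/
lemma isFiniteMeasureOnCompacts_tiltedPeak {A : Set C(E d, ℝ)} (hA : MeasurableSet A) :
    IsFiniteMeasureOnCompacts (tiltedPeak P W A) := by
  have := hW.isAddLeftInvariant_tiltedPeak hlim hA
  have hU : IsOpen ({t : E d | ∀ k, t k ∈ Ioo (0 : ℝ) 1} ×ˢ Ioo (0 : ℝ) 1) :=
    isOpen_openUnitCube.prod isOpen_Ioo
  refine ⟨fun K hK => measure_lt_top_of_isCompact_of_isAddLeftInvariant _ hU ?_ ?_ hK⟩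
  · refine ⟨(WithLp.toLp 2 fun _ => 1 / 2, 1 / 2), fun k => ?_, ?_⟩ <;> norm_num
  · have hlt := hW.peakIntensity_box_lt_top hlim
    refine (lt_of_le_of_lt ?_ (ENNReal.mul_lt_top (ENNReal.ofReal_lt_top (r := Real.exp 1)) hlt)).ne
    have hbox : MeasurableSet {p : E d × ℝ × C(E d, ℝ) |
        (∀ k, p.1 k ∈ Ioo (0 : ℝ) 1) ∧ p.2.1 ∈ Icc (0 : ℝ) 1} :=
      (isOpen_openUnitCube.measurableSet.preimage measurable_fst).inter
        (measurableSet_Icc.preimage (measurable_fst.comp measurable_snd))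
    rw [← lintegral_indicator_one hU.measurableSet,
      lintegral_tiltedPeak hA (measurable_one.indicator hU.measurableSet),
      ← lintegral_indicator_one hbox, ← lintegral_const_mul' _ _ ENNReal.ofReal_ne_top]
    refine lintegral_mono fun p => ?_
    refine (indicator_le_self' (fun _ _ => zero_le) p).trans ?_
    by_cases hp : (p.1, p.2.1) ∈ {t : E d | ∀ k, t k ∈ Ioo (0 : ℝ) 1} ×ˢ Ioo (0 : ℝ) 1
    · have hp' : p ∈ {p : E d × ℝ × C(E d, ℝ) |
          (∀ k, p.1 k ∈ Ioo (0 : ℝ) 1) ∧ p.2.1 ∈ Icc (0 : ℝ) 1} :=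
        ⟨hp.1, Ioo_subset_Icc_self hp.2⟩
      rw [indicator_of_mem hp, indicator_of_mem hp']
      refine mul_le_mul_left (ENNReal.ofReal_le_ofReal (Real.exp_le_exp.2 ?_)) _
      exact hp'.2.2
    · rw [indicator_of_notMem hp, mul_zero]
      exact zero_le

/-- Uniqueness of Haar measure on `ℝᵈ × ℝ`; the constant is read off on the unit cube, which has
volume one. -/
lemma tiltedPeak_eq_smul {A : Set C(E d, ℝ)} (hA : MeasurableSet A) :
    tiltedPeak P W A = shapeMeasure P W A • (volume : Measure (E d)).prod (volume : Measure ℝ) := by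
  have := hW.isAddLeftInvariant_tiltedPeak hlim hA
  have := hW.isFiniteMeasureOnCompacts_tiltedPeak hlim hA
  have h := Measure.isAddLeftInvariant_eq_smul (tiltedPeak P W A)
    ((volume : Measure (E d)).prod (volume : Measure ℝ))
  have h1 := tiltedPeak_unitCube (P := P) (W := W) hA
  rw [h, Measure.smul_apply, Measure.prod_prod, volume_unitCube,
    Real.volume_Icc] at h1
  simp only [sub_zero, ENNReal.ofReal_one, mul_one] at h1
  rw [← h1]
  conv_lhs => rw [h]
  rw [smul_assoc, one_smul]

lemma isFiniteMeasure_shapeMeasure : IsFiniteMeasure (shapeMeasure P W) := by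
  have := hW.isFiniteMeasureOnCompacts_tiltedPeak hlim MeasurableSet.univ
  refine ⟨?_⟩
  rw [← tiltedPeak_unitCube MeasurableSet.univ]
  exact (isCompact_unitCube.prod isCompact_Icc).measure_lt_top

lemma peakIntensity_prod {B : Set (E d)} (hB : MeasurableSet B) {I : Set ℝ} (hI : MeasurableSet I)
    {A : Set C(E d, ℝ)} (hA : MeasurableSet A) :
    peakIntensity P W (B ×ˢ (I ×ˢ A)) =
      (volume : Measure (E d)) B * (expIntensity I * shapeMeasure P W A) := by
  have hBI : MeasurableSet (B ×ˢ I) := hB.prod hI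
  -- Testing against `e^{-y}` on `B ×ˢ I` removes the weight `e^y`.
  have hψ : Measurable (fun q : E d × ℝ =>
      (B ×ˢ I).indicator (fun q => ENNReal.ofReal (Real.exp (-q.2))) q) :=
    Measurable.indicator (by fun_prop) hBI
  have h1 := lintegral_tiltedPeak (P := P) (W := W) hA hψ
  rw [hW.tiltedPeak_eq_smul hlim hA, lintegral_smul_measure, lintegral_indicator hBI,
    setLIntegral_prod _ (by fun_prop)] at h1
  simp only [lintegral_const, Measure.restrict_apply, MeasurableSet.univ, univ_inter] at h1
  have h2 : ∫⁻ y in I, ENNReal.ofReal (Real.exp (-y)) = expIntensity I := by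
    rw [expIntensity, withDensity_apply _ hI]
  rw [h2, smul_eq_mul] at h1
  rw [mul_comm (expIntensity I), ← mul_assoc, mul_comm _ (shapeMeasure P W A), mul_assoc,
    mul_comm (volume B), h1, ← lintegral_indicator_one (hB.prod (hI.prod hA))]
  refine lintegral_congr fun p => ?_
  let D : Set (E d × ℝ × C(E d, ℝ)) := {p | p.2.2 ∈ A}
  by_cases hp : p ∈ D
  · by_cases hq : (p.1, p.2.1) ∈ B ×ˢ I
    · have : p ∈ B ×ˢ (I ×ˢ A) := ⟨hq.1, hq.2, hp⟩
      rw [indicator_of_mem this, indicator_of_mem (s := D) hp, indicator_of_mem hq,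
        ← ENNReal.ofReal_mul (Real.exp_pos _).le, ← Real.exp_add]
      simp
    · have : p ∉ B ×ˢ (I ×ˢ A) := fun h => hq ⟨h.1, h.2.1⟩
      rw [indicator_of_notMem this, indicator_of_mem (s := D) hp,
        indicator_of_notMem hq, mul_zero]
  · have : p ∉ B ×ˢ (I ×ˢ A) := fun h => hp h.2.2
    rw [indicator_of_notMem this, indicator_of_notMem (s := D) hp]

lemma peakIntensity_eq_prod_shapeMeasure :
    peakIntensity P W =
      (volume : Measure (E d)).prod (expIntensity.prod (shapeMeasure P W)) := by
  have := hW.isFiniteMeasure_shapeMeasure hlim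
  symm
  refine Measure.prod_eq_generateFrom MeasurableSpace.generateFrom_measurableSet generateFrom_prod
    MeasurableSpace.isPiSystem_measurableSet isPiSystem_prod
    (volume : Measure (E d)).toFiniteSpanningSetsIn
    (expIntensity.toFiniteSpanningSetsIn.prod (shapeMeasure P W).toFiniteSpanningSetsIn) ?_
  rintro B hB _ ⟨I, hI, A, hA, rfl⟩
  rw [hW.peakIntensity_prod hlim hB hI hA, Measure.prod_prod]

lemma lambdaStar_lt_top : lambdaStar P W < ∞ :=
  (hW.isFiniteMeasure_shapeMeasure hlim).measure_univ_lt_top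

/-- Otherwise `Ψ`, and with it the function intensity, would vanish, although its total mass is that
of `e^{-x} dx`, which is infinite. -/
lemma lambdaStar_pos : 0 < lambdaStar P W := by
  have := hW.isProbabilityMeasure
  rw [pos_iff_ne_zero, lambdaStar, ne_eq, Measure.measure_univ_eq_zero]
  intro h0
  have h1 := hW.peakIntensity_eq_prod_shapeMeasure hlim
  rw [h0, Measure.prod_zero, Measure.prod_zero, hW.peakIntensity_eq_map hlim,
    Measure.map_eq_zero_iff measurable_peak₀.aemeasurable, functionIntensity,
    Measure.map_eq_zero_iff hW.measurable_translate_driftedMap.aemeasurable,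
    ← Measure.measure_univ_eq_zero, ← univ_prod_univ, Measure.prod_prod, expIntensity_univ,
    measure_univ] at h1
  simp at h1

lemma shapeMeasure_eq_smul : shapeMeasure P W = lambdaStar P W • shapeLaw P W := by
  rw [shapeLaw, smul_smul, ENNReal.mul_inv_cancel (hW.lambdaStar_pos hlim).ne'
    (hW.lambdaStar_lt_top hlim).ne, one_smul]

lemma isProbabilityMeasure_shapeLaw : IsProbabilityMeasure (shapeLaw P W) := by
  refine ⟨?_⟩
  rw [shapeLaw, Measure.smul_apply, smul_eq_mul]
  exact ENNReal.inv_mul_cancel (hW.lambdaStar_pos hlim).ne' (hW.lambdaStar_lt_top hlim).ne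

lemma peakIntensity_eq_smul_prod :
    peakIntensity P W = lambdaStar P W • (volume : Measure (E d)).prod
      (expIntensity.prod (shapeLaw P W)) := by
  have := hW.isProbabilityMeasure_shapeLaw hlim
  rw [hW.peakIntensity_eq_prod_shapeMeasure hlim, hW.shapeMeasure_eq_smul hlim,
    Measure.prod_smul_right, Measure.prod_smul_right]

/-- The functions `U i + F i (· - S i)` have the same intensity as the functions `X i + ξ i`. -/
lemma functionIntensity_eq_map_shift : functionIntensity P W =
    ((lambdaStar P W • (volume : Measure (E d)).prod expIntensity).prod (shapeLaw P W)).map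
      (fun p => BrownResnick.translate (-p.1.1) p.1.2 p.2) := by
  have := hW.isProbabilityMeasure_shapeLaw hlim
  have hm : Measurable (fun p : E d × ℝ × C(E d, ℝ) =>
      BrownResnick.translate (-p.1) p.2.1 p.2.2) :=
    measurable_translate_uncurry.comp (measurable_fst.neg.prodMk measurable_snd)
  rw [hW.functionIntensity_eq_map_peakIntensity hlim, hW.peakIntensity_eq_smul_prod hlim,
    Measure.prod_smul_left, Measure.map_smul, Measure.map_smul,
    ← (measurePreserving_prodAssoc (volume : Measure (E d)) expIntensity
      (shapeLaw P W)).map_eq, Measure.map_map hm MeasurableEquiv.prodAssoc.measurable]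
  rfl

end IsGaussianFieldWithVariogram

end Peak

/-! ### Poisson processes: mean measure and Laplace functional -/

section Poisson

variable {Ω S : Type*} [MeasurableSpace Ω] [MeasurableSpace S]

omit [MeasurableSpace Ω] [MeasurableSpace S] in
lemma toENNReal_pointCount (X : ℕ → Ω → S) (A : Set S) (ω : Ω) :
    (pointCount X A ω : ℝ≥0∞) = ∑' i, A.indicator 1 (X i ω) := by
  rw [pointCount, ← ENNReal.tsum_set_one, tsum_subtype {i : ℕ | X i ω ∈ A} (fun _ => (1 : ℝ≥0∞))]
  rfl

lemma measurable_pointCount {X : ℕ → Ω → S} (hX : ∀ i, Measurable (X i)) {A : Set S}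
    (hA : MeasurableSet A) : Measurable (pointCount X A) := by
  have h : Measurable (fun ω => (pointCount X A ω : ℝ≥0∞)) := by
    simp_rw [toENNReal_pointCount]
    exact Measurable.tsum fun i => (measurable_one.indicator hA).comp (hX i)
  refine measurable_to_countable' fun n => ?_
  have : pointCount X A ⁻¹' {n} = (fun ω => (pointCount X A ω : ℝ≥0∞)) ⁻¹' {(n : ℝ≥0∞)} := by
    ext ω
    simp
  rw [this]
  exact h (measurableSet_singleton _)

lemma lintegral_poissonMeasure (r : NNReal) (f : ℕ → ℝ≥0∞) :
    ∫⁻ n, f n ∂(poissonMeasure r) =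
      ∑' n : ℕ, ENNReal.ofReal (Real.exp (-r) * r ^ n / n.factorial) * f n := by
  rw [poissonMeasure, lintegral_sum_measure]
  simp [lintegral_smul_measure]

lemma lintegral_cast_poissonMeasure (r : NNReal) :
    ∫⁻ n : ℕ, (n : ℝ≥0∞) ∂(poissonMeasure r) = r := by
  rw [lintegral_poissonMeasure, tsum_eq_zero_add' ENNReal.summable]
  have h : ∀ n : ℕ, ENNReal.ofReal (Real.exp (-r) * r ^ (n + 1) / (n + 1).factorial) *
      ((n + 1 : ℕ) : ℝ≥0∞) =
      r * (ENNReal.ofReal (Real.exp (-r) * r ^ n / n.factorial) * 1) := by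
    intro n
    rw [← ENNReal.ofReal_natCast, ← ENNReal.ofReal_mul (by positivity), mul_one,
      ← ENNReal.ofReal_coe_nnreal, ← ENNReal.ofReal_mul (by positivity), Nat.factorial_succ]
    congr 1
    push_cast
    field_simp
    ring
  simp_rw [h]
  rw [ENNReal.tsum_mul_left, ← lintegral_poissonMeasure]
  simp

lemma lintegral_pow_poissonMeasure (r : NNReal) {s : ℝ≥0∞} (hs : s ≤ 1) :
    ∫⁻ n : ℕ, s ^ n ∂(poissonMeasure r) =
      ENNReal.ofReal (Real.exp (-(r * (1 - s)).toReal)) := by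
  lift s to NNReal using (hs.trans_lt ENNReal.one_lt_top).ne
  have hs' : s ≤ 1 := by exact_mod_cast hs
  have h1 : (r * (1 - s : ℝ≥0∞)).toReal = r * (1 - s) := by
    rw [ENNReal.toReal_mul, ENNReal.toReal_sub_of_le hs ENNReal.one_ne_top]
    simp
  rw [lintegral_poissonMeasure, h1]
  have h : ∀ n : ℕ, ENNReal.ofReal (Real.exp (-r) * r ^ n / n.factorial) * (s : ℝ≥0∞) ^ n =
      ENNReal.ofReal (Real.exp (-(r * (1 - s)))) *
        (ENNReal.ofReal (Real.exp (-(r * s : NNReal)) * (r * s : NNReal) ^ n / n.factorial) *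
          1) := by
    intro n
    rw [← ENNReal.coe_pow, ← ENNReal.ofReal_coe_nnreal, ← ENNReal.ofReal_mul (by positivity),
      mul_one, ← ENNReal.ofReal_mul (by positivity)]
    congr 1
    have : Real.exp (-(r : ℝ)) = Real.exp (-(r * (1 - s))) * Real.exp (-(r * s)) := by
      rw [← Real.exp_add]
      congr 1
      ring
    rw [this]
    push_cast
    ring
  simp_rw [h]
  rw [ENNReal.tsum_mul_left, ← lintegral_poissonMeasure]
  simp

namespace IsPoissonProcess

variable {P : Measure Ω} {X : ℕ → Ω → S} {μ : Measure S}
  (hX : IsPoissonProcess P X μ)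
include hX

lemma lintegral_pointCount {A : Set S} (hA : MeasurableSet A) (hμ : μ A ≠ ∞)
    (f : ℕ∞ → ℝ≥0∞) :
    ∫⁻ ω, f (pointCount X A ω) ∂P = ∫⁻ n : ℕ, f n ∂(poissonMeasure (μ A).toNNReal) := by
  rw [← lintegral_map (f := f) (g := pointCount X A) (Measurable.of_discrete)
    (measurable_pointCount hX.measurable hA), hX.law_of_ne_top A hA hμ,
    lintegral_map Measurable.of_discrete Measurable.of_discrete]

lemma ae_pointCount_ne_top {A : Set S} (hA : MeasurableSet A) (hμ : μ A ≠ ∞) :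
    ∀ᵐ ω ∂P, pointCount X A ω ≠ ⊤ := by
  have hm := measurable_pointCount hX.measurable hA
  have h : ∀ᵐ n ∂(P.map (pointCount X A)), n ≠ ⊤ := by
    rw [hX.law_of_ne_top A hA hμ, ae_map_iff Measurable.of_discrete.aemeasurable
      (MeasurableSet.of_discrete)]
    exact ae_of_all _ fun n => ENat.natCast_ne_top n
  exact ae_of_ae_map hm.aemeasurable h

/-- The mean measure of a Poisson process is its intensity measure. -/
lemma sum_map_eq [IsProbabilityMeasure P] : Measure.sum (fun i => P.map (X i)) = μ := by
  ext A hA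
  rw [Measure.sum_apply _ hA]
  have h1 : ∀ i, P.map (X i) A = ∫⁻ ω, A.indicator 1 (X i ω) ∂P := by
    intro i
    rw [← lintegral_indicator_one hA, lintegral_map (measurable_one.indicator hA) (hX.measurable i)]
  simp_rw [h1]
  rw [← lintegral_tsum (f := fun i ω => A.indicator 1 (X i ω)) fun i =>
    ((measurable_one.indicator hA).comp (hX.measurable i)).aemeasurable]
  simp_rw [← toENNReal_pointCount]
  by_cases hμ : μ A = ∞
  · rw [hμ, lintegral_congr_ae (g := fun _ => ∞)]
    · simp
    · filter_upwards [hX.law_of_eq_top A hA hμ] with ω hω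
      rw [hω, ENat.toENNReal_top]
  · rw [hX.lintegral_pointCount hA hμ (fun n => (n : ℝ≥0∞))]
    simp only [ENat.toENNReal_coe]
    rw [lintegral_cast_poissonMeasure, ENNReal.coe_toNNReal hμ]

-- Every point in `A j` contributes a factor `s j`, so the product is `∏ s j ^ N j` with independent
-- Poisson counts, and the generating functions multiply. The infinite product is an infimum because
-- its partial products decrease.
open Classical in
lemma lintegral_iInf_prod_of_disjoint {n : ℕ} {A : Fin n → Set S}
    (hA : ∀ j, MeasurableSet (A j)) (hdisj : Pairwise fun j k => Disjoint (A j) (A k))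
    (hμ : ∀ j, μ (A j) ≠ ∞) {s : Fin n → ℝ≥0∞} (hs : ∀ j, s j ≤ 1) {h : S → ℝ≥0∞}
    (hh : ∀ x, h x = ∏ j, (A j).piecewise (fun _ => s j) (fun _ => 1) x) :
    ∫⁻ ω, ⨅ N : ℕ, ∏ i ∈ Finset.range N, h (X i ω) ∂P =
      ENNReal.ofReal (Real.exp (-(∑ j, μ (A j) * (1 - s j)).toReal)) := by
  classical
  have hmeas := hX.measurable
  have hfin : ∀ᵐ ω ∂P, ∀ j, pointCount X (A j) ω ≠ ⊤ :=
    ae_all_iff.2 fun j => hX.ae_pointCount_ne_top (hA j) (hμ j)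
  have hpt : ∀ᵐ ω ∂P, ⨅ N : ℕ, ∏ i ∈ Finset.range N, h (X i ω) =
      ∏ j, s j ^ (pointCount X (A j) ω).toNat := by
    filter_upwards [hfin] with ω hω
    have hf : ∀ j, {i : ℕ | X i ω ∈ A j}.Finite := fun j => by
      have := hω j
      rwa [pointCount, ne_eq, Set.encard_eq_top_iff, Set.not_infinite] at this
    have hle : ∀ x, h x ≤ 1 := by
      intro x
      rw [hh]
      refine Finset.prod_le_one' fun j _ => ?_
      by_cases hx : x ∈ A j
      · simpa [hx] using hs j
      · simp [hx]
    have hanti : Antitone fun N : ℕ => ∏ i ∈ Finset.range N, h (X i ω) :=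
      antitone_nat_of_succ_le fun N => by
        rw [Finset.prod_range_succ]
        exact mul_le_of_le_one_right' (hle _)
    have hev : ∀ᶠ N in atTop, ∏ i ∈ Finset.range N, h (X i ω) =
        ∏ j, s j ^ (pointCount X (A j) ω).toNat := by
      have hb : ∀ᶠ N in atTop, ∀ j, ∀ i ∈ {i : ℕ | X i ω ∈ A j}, i < N := by
        refine eventually_all.2 fun j => ?_
        obtain ⟨M, hM⟩ := (hf j).bddAbove
        filter_upwards [eventually_gt_atTop M] with N hN i hi
        exact (hM hi).trans_lt hN
      filter_upwards [hb] with N hN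
      simp_rw [hh]
      rw [Finset.prod_comm]
      refine Finset.prod_congr rfl fun j _ => ?_
      have hset : {i : ℕ | X i ω ∈ A j} =
          (((Finset.range N).filter fun i => X i ω ∈ A j : Finset ℕ) : Set ℕ) := by
        ext i
        simp only [mem_ofPred_eq, Finset.coe_filter, Finset.mem_range]
        exact ⟨fun hi => ⟨hN j i hi, hi⟩, fun hi => hi.2⟩
      rw [pointCount, hset, Set.encard_coe_eq_coe_finsetCard, ENat.toNat_natCast,
        ← Finset.prod_const, Finset.prod_filter]
      refine Finset.prod_congr rfl fun i _ => ?_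
      by_cases hx : X i ω ∈ A j <;> simp [hx]
    exact tendsto_nhds_unique (tendsto_atTop_iInf hanti) (tendsto_const_nhds.congr' (hev.mono
      fun _ h => h.symm))
  rw [lintegral_congr_ae hpt]
  have hind := (hX.indep n A hA hdisj).comp (fun j (m : ℕ∞) => s j ^ m.toNat)
    (fun j => Measurable.of_discrete)
  have h1 := lintegral_prod_eq_prod_lintegral_of_indepFun Finset.univ
    (fun j ω => s j ^ (pointCount X (A j) ω).toNat) hind
    (fun j => (Measurable.of_discrete (f := fun m : ℕ∞ => s j ^ m.toNat)).comp
      (measurable_pointCount hmeas (hA j)))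
  rw [h1]
  have h2 : ∀ j, ∫⁻ ω, s j ^ (pointCount X (A j) ω).toNat ∂P =
      ENNReal.ofReal (Real.exp (-(μ (A j) * (1 - s j)).toReal)) := by
    intro j
    rw [hX.lintegral_pointCount (hA j) (hμ j) (fun m => s j ^ m.toNat)]
    simp only [ENat.toNat_natCast]
    rw [lintegral_pow_poissonMeasure _ (hs j), ENNReal.coe_toNNReal (hμ j)]
  simp_rw [h2]
  rw [← ENNReal.ofReal_prod_of_nonneg fun _ _ => (Real.exp_pos _).le, ← Real.exp_sum,
    ENNReal.toReal_sum fun j _ => ENNReal.mul_ne_top (hμ j)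
      (ENNReal.sub_ne_top ENNReal.one_ne_top), Finset.sum_neg_distrib]

lemma lintegral_iInf_prod_simpleFunc (φ : SimpleFunc S ℝ≥0∞) (hφ : ∀ x, φ x ≤ 1)
    (hint : ∫⁻ x, φ x ∂μ ≠ ∞) :
    ∫⁻ ω, ⨅ N : ℕ, ∏ i ∈ Finset.range N, (1 - φ (X i ω)) ∂P =
      ENNReal.ofReal (Real.exp (-(∫⁻ x, φ x ∂μ).toReal)) := by
  classical
  -- The value `0` is dropped since its fibre may have infinite measure; finiteness of the integral
  -- makes the other fibres finite.
  set R := φ.range.erase 0 with hR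
  let e := R.equivFin
  have hsum : ∫⁻ x, φ x ∂μ = ∑ a ∈ R, a * μ (φ ⁻¹' {a}) := by
    rw [SimpleFunc.lintegral_eq_lintegral, SimpleFunc.lintegral, hR]
    refine (Finset.sum_erase _ ?_).symm
    simp
  have hle1 : ∀ a ∈ R, a ≤ 1 := by
    intro a ha
    obtain ⟨x, rfl⟩ := SimpleFunc.mem_range.1 (Finset.mem_of_mem_erase ha)
    exact hφ x
  have hfin : ∀ a ∈ R, μ (φ ⁻¹' {a}) ≠ ∞ := by
    intro a ha htop
    rw [hsum] at hint
    refine hint (ENNReal.sum_eq_top.2 ⟨a, ha, ?_⟩)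
    rw [htop, ENNReal.mul_top (Finset.ne_of_mem_erase ha)]
  rw [hX.lintegral_iInf_prod_of_disjoint (A := fun j => φ ⁻¹' {(e.symm j : ℝ≥0∞)})
    (s := fun j => 1 - (e.symm j : ℝ≥0∞)) (fun j => φ.measurableSet_fiber _) ?_
    (fun j => hfin _ (e.symm j).2) (fun j => tsub_le_self) (h := fun x => 1 - φ x) ?_]
  · congr 3
    rw [hsum, ← Finset.sum_coe_sort R, ← e.symm.sum_comp]
    refine congrArg _ (Finset.sum_congr rfl fun j _ => ?_)
    rw [ENNReal.sub_sub_cancel ENNReal.one_ne_top (hle1 _ (e.symm j).2), mul_comm]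
  · intro j k hjk
    refine Disjoint.preimage _ (disjoint_singleton.2 fun h => hjk ?_)
    exact e.symm.injective (Subtype.ext h)
  · intro x
    rw [e.symm.prod_comp (fun a : R =>
      (φ ⁻¹' {(a : ℝ≥0∞)}).piecewise (fun _ => 1 - (a : ℝ≥0∞)) (fun _ => 1) x),
      Finset.prod_coe_sort R (fun a =>
        (φ ⁻¹' {a}).piecewise (fun _ => 1 - a) (fun _ => (1 : ℝ≥0∞)) x)]
    by_cases hx : φ x = 0
    · rw [Finset.prod_eq_one, hx, tsub_zero]
      intro a ha
      have : x ∉ φ ⁻¹' {a} := fun h => Finset.ne_of_mem_erase ha (h.symm.trans hx)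
      rw [piecewise_eq_of_notMem _ _ _ this]
    · rw [Finset.prod_eq_single_of_mem (φ x) (Finset.mem_erase.2 ⟨hx, φ.mem_range_self x⟩)]
      · have : x ∈ φ ⁻¹' {φ x} := rfl
        rw [piecewise_eq_of_mem _ _ _ this]
      · intro a _ hne
        have : x ∉ φ ⁻¹' {a} := fun h => hne h.symm
        rw [piecewise_eq_of_notMem _ _ _ this]

/-- The Laplace functional of a Poisson process, in multiplicative form. -/
lemma lintegral_iInf_prod [IsProbabilityMeasure P] {p : S → ℝ≥0∞} (hp : Measurable p)
    (hp1 : ∀ x, p x ≤ 1) (hint : ∫⁻ x, p x ∂μ ≠ ∞) :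
    ∫⁻ ω, ⨅ N : ℕ, ∏ i ∈ Finset.range N, (1 - p (X i ω)) ∂P =
      ENNReal.ofReal (Real.exp (-(∫⁻ x, p x ∂μ).toReal)) := by
  let φ := SimpleFunc.eapprox p
  have hφp : ∀ n x, φ n x ≤ p x := fun n x => by
    rw [← SimpleFunc.iSup_eapprox_apply hp x]
    exact le_iSup (fun n => φ n x) n
  have hφmono : Monotone φ := SimpleFunc.monotone_eapprox p
  let L : ℕ → Ω → ℝ≥0∞ := fun n ω => ⨅ N : ℕ, ∏ i ∈ Finset.range N, (1 - φ n (X i ω))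
  have hLm : ∀ n, Measurable (L n) := fun n => Measurable.iInf fun N =>
    Finset.measurable_prod _ fun i _ =>
      measurable_const.sub ((φ n).measurable.comp (hX.measurable i))
  have hLanti : Antitone L := fun m n hmn ω => iInf_mono fun N =>
    Finset.prod_le_prod' fun i _ => tsub_le_tsub_left (hφmono hmn _) _
  have hL1 : ∀ n ω, L n ω ≤ 1 := fun n ω => (iInf_le _ 0).trans (by simp)
  -- The two infima, over approximations of `p` and over partial products, may be exchanged; a
  -- finite product is continuous in its factors.
  have hLinf : ∀ ω, ⨅ N : ℕ, ∏ i ∈ Finset.range N, (1 - p (X i ω)) = ⨅ n, L n ω := by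
    intro ω
    refine le_antisymm (le_iInf fun n => iInf_mono fun N => Finset.prod_le_prod' fun i _ =>
      tsub_le_tsub_left (hφp n _) _) (le_iInf fun N => ?_)
    have htend : Tendsto (fun n => ∏ i ∈ Finset.range N, (1 - φ n (X i ω))) atTop
        (𝓝 (∏ i ∈ Finset.range N, (1 - p (X i ω)))) := by
      refine ENNReal.tendsto_finsetProd_of_ne_top _ (fun i _ => ?_) fun i _ =>
        ENNReal.sub_ne_top ENNReal.one_ne_top
      exact ENNReal.Tendsto.sub tendsto_const_nhds (SimpleFunc.tendsto_eapprox hp _)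
        (Or.inl ENNReal.one_ne_top)
    exact ge_of_tendsto' htend fun n => (iInf_le _ n).trans (iInf_le _ N)
  simp_rw [hLinf]
  rw [lintegral_iInf hLm hLanti (((lintegral_mono (hL1 0)).trans_lt (by simp)).ne)]
  have hval : ∀ n, ∫⁻ ω, L n ω ∂P = ENNReal.ofReal (Real.exp (-(∫⁻ x, φ n x ∂μ).toReal)) :=
    fun n => hX.lintegral_iInf_prod_simpleFunc (φ n) (fun x => (hφp n x).trans (hp1 x))
      ((lintegral_mono (hφp n)).trans_lt hint.lt_top).ne
  have ht1 : Tendsto (fun n => ∫⁻ ω, L n ω ∂P) atTop (𝓝 (⨅ n, ∫⁻ ω, L n ω ∂P)) :=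
    tendsto_atTop_iInf fun m n hmn => lintegral_mono (hLanti hmn)
  have ht2 : Tendsto (fun n => ∫⁻ x, φ n x ∂μ) atTop (𝓝 (∫⁻ x, p x ∂μ)) :=
    lintegral_tendsto_of_tendsto_of_monotone (fun n => (φ n).measurable.aemeasurable)
      (ae_of_all _ fun x m n hmn => hφmono hmn x)
      (ae_of_all _ fun x => SimpleFunc.tendsto_eapprox hp x)
  refine tendsto_nhds_unique ht1 ?_
  simp_rw [hval]
  refine ENNReal.tendsto_ofReal ((Real.continuous_exp.tendsto _).comp
    ((ENNReal.tendsto_toReal hint).comp ht2).neg)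

/-! ### Independent marking -/

section Marking

variable {G : Type*} [MeasurableSpace G] {Y : ℕ → Ω → G} {ν : Measure G}
  [IsProbabilityMeasure P]
  (hYm : ∀ i, Measurable (Y i)) (hYlaw : ∀ i, P.map (Y i) = ν)
  (hind : IndepFun (fun ω i => X i ω) (fun ω i => Y i ω) P)
include hYm hYlaw hind

/-- Borel–Cantelli: the probabilities that the `i`-th marked point lies in `B` sum to the mean
number of such points, `μ.prod ν B`. -/
lemma ae_finite_marked {B : Set (S × G)} (hB : MeasurableSet B)
    (hfin : μ.prod ν B ≠ ∞) : ∀ᵐ ω ∂P, {i | (X i ω, Y i ω) ∈ B}.Finite := by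
  have hν : IsProbabilityMeasure ν :=
    hYlaw 0 ▸ Measure.isProbabilityMeasure_map (hYm 0).aemeasurable
  refine ae_finite_setOfPred_mem (s := fun i => {ω | (X i ω, Y i ω) ∈ B}) ?_
  have h1 : ∀ i, P {ω | (X i ω, Y i ω) ∈ B} = (P.map (X i)).prod ν B := by
    intro i
    have hi : IndepFun (X i) (Y i) P :=
      hind.comp (measurable_pi_apply i) (measurable_pi_apply i)
    rw [← hYlaw i, ← (indepFun_iff_map_prod_eq_prod_map_map (hX.measurable i).aemeasurable
      (hYm i).aemeasurable).1 hi, Measure.map_apply ((hX.measurable i).prodMk (hYm i)) hB]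
    rfl
  simp_rw [h1]
  rw [← Measure.sum_apply _ hB, ← Measure.prod_sum_left, hX.sum_map_eq]
  exact hfin

/-- Given the points, independent marks avoid `B` with probability `∏ (1 - p (X i))`, where `p x` is
the `ν`-mass of the section of `B` at `x`; the Laplace functional integrates this. -/
lemma measure_forall_notMem (hYind : iIndepFun Y P) {B : Set (S × G)} (hB : MeasurableSet B)
    (hfin : μ.prod ν B ≠ ∞) :
    P {ω | ∀ i, (X i ω, Y i ω) ∉ B} = ENNReal.ofReal (Real.exp (-(μ.prod ν B).toReal)) := by
  have hν : IsProbabilityMeasure ν :=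
    hYlaw 0 ▸ Measure.isProbabilityMeasure_map (hYm 0).aemeasurable
  have hXs : Measurable fun ω i => X i ω := measurable_pi_iff.2 hX.measurable
  have hYs : Measurable fun ω i => Y i ω := measurable_pi_iff.2 hYm
  have hpm : Measurable fun x => ν (Prod.mk x ⁻¹' B) := measurable_measure_prodMk_left hB
  have hN : ∀ N : ℕ, P {ω | ∀ i ∈ Finset.range N, (X i ω, Y i ω) ∉ B} =
      ∫⁻ ω, ∏ i ∈ Finset.range N, (1 - ν (Prod.mk (X i ω) ⁻¹' B)) ∂P := by
    intro N
    let C : Set ((ℕ → S) × (ℕ → G)) := {q | ∀ i ∈ Finset.range N, (q.1 i, q.2 i) ∉ B}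
    have hC : MeasurableSet C := by
      simp only [C, ofPred_forall]
      refine MeasurableSet.iInter fun i => MeasurableSet.iInter fun _ => ?_
      refine (hB.preimage (f := fun q : (ℕ → S) × (ℕ → G) => (q.1 i, q.2 i)) ?_).compl
      exact ((measurable_pi_apply i).comp measurable_fst).prodMk
        ((measurable_pi_apply i).comp measurable_snd)
    have h1 : P {ω | ∀ i ∈ Finset.range N, (X i ω, Y i ω) ∉ B} =
        ((P.map fun ω i => X i ω).prod (P.map fun ω i => Y i ω)) C := by
      rw [← (indepFun_iff_map_prod_eq_prod_map_map hXs.aemeasurable hYs.aemeasurable).1 hind,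
        Measure.map_apply (hXs.prodMk hYs) hC]
      rfl
    have := Measure.isProbabilityMeasure_map (μ := P) hYs.aemeasurable
    rw [h1, Measure.prod_apply hC, lintegral_map (measurable_measure_prodMk_left hC) hXs]
    refine lintegral_congr fun ω => ?_
    rw [Measure.map_apply hYs (measurable_prodMk_left hC)]
    have h2 : ((fun ω' i => Y i ω') ⁻¹' (Prod.mk (fun i => X i ω) ⁻¹' C)) =
        ⋂ i ∈ Finset.range N, Y i ⁻¹' (Prod.mk (X i ω) ⁻¹' B)ᶜ := by
      ext ω'
      simp [C]
    rw [h2, hYind.measure_inter_preimage_eq_mul (Finset.range N)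
      (fun i _ => (measurable_prodMk_left hB).compl)]
    refine Finset.prod_congr rfl fun i _ => ?_
    rw [← Measure.map_apply (hYm i) (measurable_prodMk_left hB).compl, hYlaw i,
      prob_compl_eq_one_sub (measurable_prodMk_left hB)]
  have hset : {ω | ∀ i, (X i ω, Y i ω) ∉ B} =
      ⋂ N : ℕ, {ω | ∀ i ∈ Finset.range N, (X i ω, Y i ω) ∉ B} := by
    ext ω
    simp only [mem_ofPred_eq, mem_iInter, Finset.mem_range]
    exact ⟨fun h N i _ => h i, fun h i => h (i + 1) i i.lt_succ_self⟩
  have hanti : Antitone fun N : ℕ => {ω | ∀ i ∈ Finset.range N, (X i ω, Y i ω) ∉ B} :=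
    fun M N hMN ω hω i hi => hω i (Finset.range_mono hMN hi)
  have hmeas : ∀ N : ℕ, MeasurableSet {ω | ∀ i ∈ Finset.range N, (X i ω, Y i ω) ∉ B} := by
    intro N
    simp only [ofPred_forall]
    exact MeasurableSet.iInter fun i => MeasurableSet.iInter fun _ =>
      (hB.preimage ((hX.measurable i).prodMk (hYm i))).compl
  rw [hset, hanti.measure_iInter (fun N => (hmeas N).nullMeasurableSet) ⟨0, measure_ne_top _ _⟩]
  simp_rw [hN]
  rw [Measure.prod_apply hB] at hfin ⊢
  rw [← hX.lintegral_iInf_prod hpm (fun x => prob_le_one) hfin, lintegral_iInf]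
  · exact fun N => Finset.measurable_prod _ fun i _ =>
      measurable_const.sub (hpm.comp (hX.measurable i))
  · refine antitone_nat_of_succ_le fun N ω => ?_
    simp only [Finset.prod_range_succ]
    exact mul_le_of_le_one_right' tsub_le_self
  · simp

end Marking

end IsPoissonProcess

end Poisson

/-! ### Pointwise maxima of a point process of functions -/

/-- A point process of continuous functions that is locally finite, with the void probabilities of
a Poisson process with intensity measure `Λ`. -/
structure HasPoissonVoids {Ω : Type*} [MeasurableSpace Ω] (P : Measure Ω)
    (ζ : ℕ → Ω → C(E d, ℝ)) (Λ : Measure C(E d, ℝ)) : Prop where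
  measurable : ∀ i, Measurable (ζ i)
  finite : ∀ B, MeasurableSet B → Λ B ≠ ∞ → ∀ᵐ ω ∂P, {i | ζ i ω ∈ B}.Finite
  void : ∀ B, MeasurableSet B → Λ B ≠ ∞ →
    P {ω | ∀ i, ζ i ω ∉ B} = ENNReal.ofReal (Real.exp (-(Λ B).toReal))

lemma IsPoissonProcess.hasPoissonVoids {Ω S G : Type*} [MeasurableSpace Ω] [MeasurableSpace S]
    [MeasurableSpace G] {P : Measure Ω} [IsProbabilityMeasure P] {X : ℕ → Ω → S} {μ : Measure S}
    (hX : IsPoissonProcess P X μ) {Y : ℕ → Ω → G} {ν : Measure G} (hYm : ∀ i, Measurable (Y i))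
    (hYlaw : ∀ i, P.map (Y i) = ν) (hind : IndepFun (fun ω i => X i ω) (fun ω i => Y i ω) P)
    (hYind : iIndepFun Y P) {Φ : S × G → C(E d, ℝ)} (hΦ : Measurable Φ)
    {Λ : Measure C(E d, ℝ)} (hΛ : (μ.prod ν).map Φ = Λ) :
    HasPoissonVoids P (fun i ω => Φ (X i ω, Y i ω)) Λ where
  measurable i := hΦ.comp ((hX.measurable i).prodMk (hYm i))
  finite B hB hfin := by
    rw [← hΛ, Measure.map_apply hΦ hB] at hfin
    exact hX.ae_finite_marked hYm hYlaw hind (hΦ hB) hfin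
  void B hB hfin := by
    rw [← hΛ, Measure.map_apply hΦ hB] at hfin ⊢
    exact hX.measure_forall_notMem hYm hYlaw hind hYind (hΦ hB) hfin

namespace HasPoissonVoids

variable {Ω : Type*} [MeasurableSpace Ω] {P : Measure Ω}
  {ζ : ℕ → Ω → C(E d, ℝ)} {Λ : Measure C(E d, ℝ)} (hζ : HasPoissonVoids P ζ Λ)
  (hΛ : ∀ K : Set (E d), IsCompact K → ∀ c : ℝ, Λ {f | ∃ t ∈ K, c < f t} < ∞)
include hζ

lemma measurable_iSup : Measurable (fun ω (t : E d) => ⨆ i, ζ i ω t) :=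
  measurable_pi_iff.2 fun t => Measurable.iSup fun i => (measurable_eval t).comp (hζ.measurable i)

include hΛ

lemma ae_isGreatest : ∀ᵐ ω ∂P, ∀ t, IsGreatest (range fun i => ζ i ω t) (⨆ i, ζ i ω t) := by
  have hfin : ∀ᵐ ω ∂P, ∀ n m : ℕ,
      {i | ζ i ω ∈ {f : C(E d, ℝ) | ∃ t ∈ Metric.closedBall (0 : E d) n, -(m : ℝ) < f t}}.Finite :=
    ae_all_iff.2 fun n => ae_all_iff.2 fun m =>
      hζ.finite _ (measurableSet_exists_gt _ _) (hΛ _ (isCompact_closedBall _ _) _).ne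
  filter_upwards [hfin] with ω hω t
  obtain ⟨n, hn⟩ := exists_nat_ge ‖t‖
  -- With `-m` below the value of the function of index `0`, the indices exceeding `-m` at `t` form
  -- a finite nonempty set, and the maximum is attained there.
  obtain ⟨m, hm⟩ := exists_nat_gt (-(ζ 0 ω t))
  have hf : {i | -(m : ℝ) < ζ i ω t}.Finite :=
    (hω n m).subset fun i hi => ⟨t, by simpa using hn, hi⟩
  have h0 : 0 ∈ {i | -(m : ℝ) < ζ i ω t} := by
    rw [mem_ofPred_eq]
    linarith
  obtain ⟨i, hi, hmax⟩ := hf.exists_maximalFor (fun i => ζ i ω t) _ ⟨0, h0⟩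
  have hgr : IsGreatest (range fun i => ζ i ω t) (ζ i ω t) := by
    refine ⟨mem_range_self i, ?_⟩
    rintro _ ⟨j, rfl⟩
    by_cases hj : j ∈ {i | -(m : ℝ) < ζ i ω t}
    · rcases le_total (ζ j ω t) (ζ i ω t) with h | h
      · exact h
      · exact hmax hj h
    · exact (not_lt.1 hj).trans hi.le
  rw [iSup, hgr.csSup_eq]
  exact hgr

/-- The event says that no function falls in the set of those exceeding `y` somewhere on `I`, hence
is a void event. -/
lemma measure_iSup_le (I : Finset (E d)) (y : I → ℝ) :
    P {ω | ∀ t : I, ⨆ i, ζ i ω t ≤ y t} =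
      ENNReal.ofReal (Real.exp (-(Λ {f | ∃ t : I, y t < f t}).toReal)) := by
  have hB : MeasurableSet {f : C(E d, ℝ) | ∃ t : I, y t < f t} := by
    simp only [ofPred_exists]
    exact MeasurableSet.iUnion fun t => measurableSet_lt measurable_const (measurable_eval _)
  have hfin : Λ {f : C(E d, ℝ) | ∃ t : I, y t < f t} ≠ ∞ := by
    simp only [ofPred_exists]
    refine ((measure_iUnion_le _).trans_lt ?_).ne
    rw [tsum_fintype]
    refine ENNReal.sum_lt_top.2 fun t _ => ?_
    simpa using hΛ {(t : E d)} isCompact_singleton (y t)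
  rw [← hζ.void _ hB hfin]
  refine measure_congr ?_
  filter_upwards [hζ.ae_isGreatest hΛ] with ω hω
  refine propext ?_
  change (∀ t : I, ⨆ i, ζ i ω t ≤ y t) ↔ ∀ i, ζ i ω ∉ {f : C(E d, ℝ) | ∃ t : I, y t < f t}
  simp only [mem_ofPred_eq, not_exists, not_lt]
  constructor
  · exact fun h i t => ((hω t).2 ⟨i, rfl⟩).trans (h t)
  · intro h t
    obtain ⟨i, hi⟩ := (hω t).1
    exact hi ▸ h i t

end HasPoissonVoids

lemma measure_pi_ext_of_Iic {ι : Type*} [Fintype ι] {μ ν : Measure (ι → ℝ)}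
    [IsProbabilityMeasure μ] [IsProbabilityMeasure ν] (h : ∀ y, μ (Iic y) = ν (Iic y)) :
    μ = ν := by
  have hspan : ∀ _ : ι, IsCountablySpanning (range (Iic : ℝ → Set ℝ)) := fun _ =>
    ⟨fun n : ℕ => Iic (n : ℝ), fun n => mem_range_self _,
      eq_univ_of_forall fun x => mem_iUnion.2 (exists_nat_ge x)⟩
  have hgen : (MeasurableSpace.pi : MeasurableSpace (ι → ℝ)) =
      MeasurableSpace.generateFrom
        (pi univ '' pi univ fun _ : ι => range (Iic : ℝ → Set ℝ)) := by
    rw [← generateFrom_pi_eq hspan]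
    congr 1
    funext i
    rw [← borel_eq_generateFrom_Iic]
    exact BorelSpace.measurable_eq
  refine ext_of_generate_finite _ hgen (IsPiSystem.pi fun _ => isPiSystem_Iic) ?_ (by simp)
  rintro _ ⟨s, hs, rfl⟩
  choose y hy using fun i => hs i (mem_univ i)
  have : univ.pi s = Iic y := by
    rw [← pi_univ_Iic]
    exact congrArg _ (funext fun i => (hy i).symm)
  rw [this]
  exact h y

lemma identDistrib_iSup {Ω Ω' : Type*} [MeasurableSpace Ω] [MeasurableSpace Ω'] {P : Measure Ω}
    {P' : Measure Ω'} [IsProbabilityMeasure P] [IsProbabilityMeasure P']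
    {ζ : ℕ → Ω → C(E d, ℝ)} {ζ' : ℕ → Ω' → C(E d, ℝ)} {Λ : Measure C(E d, ℝ)}
    (hζ : HasPoissonVoids P ζ Λ) (hζ' : HasPoissonVoids P' ζ' Λ)
    (hΛ : ∀ K : Set (E d), IsCompact K → ∀ c : ℝ, Λ {f | ∃ t ∈ K, c < f t} < ∞) :
    IdentDistrib (fun ω (t : E d) => ⨆ i, ζ i ω t) (fun ω (t : E d) => ⨆ i, ζ' i ω t) P P' := by
  refine ⟨hζ.measurable_iSup.aemeasurable, hζ'.measurable_iSup.aemeasurable, ?_⟩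
  have := Measure.isProbabilityMeasure_map (μ := P) hζ.measurable_iSup.aemeasurable
  refine (isProjectiveLimit_map (P := P) (X := fun t ω => ⨆ i, ζ i ω t)
    hζ.measurable_iSup.aemeasurable).unique ?_
  have h' := isProjectiveLimit_map (P := P') (X := fun t ω => ⨆ i, ζ' i ω t)
    hζ'.measurable_iSup.aemeasurable
  intro I
  rw [h' I]
  have hm : Measurable (fun ω => I.restrict fun t => ⨆ i, ζ i ω t) :=
    (Finset.measurable_restrict I).comp hζ.measurable_iSup
  have hm' : Measurable (fun ω => I.restrict fun t => ⨆ i, ζ' i ω t) :=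
    (Finset.measurable_restrict I).comp hζ'.measurable_iSup
  have := Measure.isProbabilityMeasure_map (μ := P) hm.aemeasurable
  have := Measure.isProbabilityMeasure_map (μ := P') hm'.aemeasurable
  refine measure_pi_ext_of_Iic fun y => ?_
  rw [Measure.map_apply hm measurableSet_Iic, Measure.map_apply hm' measurableSet_Iic]
  exact (hζ'.measure_iSup_le hΛ I y).trans (hζ.measure_iSup_le hΛ I y).symm

/-! ### The processes `Z` and `Z₄` -/

/-- The function `f - σ² / 2`, where `σ²` is the variance of the field `W`. -/
def subHalfVariance {Ω : Type*} [MeasurableSpace Ω] (P : Measure Ω) (W : Ω → C(E d, ℝ))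
    (f : C(E d, ℝ)) : C(E d, ℝ) :=
  toContinuousMap fun t => f t - variance (fun ω => W ω t) P / 2

lemma IsGaussianFieldWithVariogram.subHalfVariance_apply {Ω : Type*} [MeasurableSpace Ω]
    {P : Measure Ω} {W : Ω → C(E d, ℝ)} {γ : E d → ℝ} (hW : IsGaussianFieldWithVariogram P W γ)
    (f : C(E d, ℝ)) (t : E d) :
    subHalfVariance P W f t = f t - variance (fun ω => W ω t) P / 2 :=
  toContinuousMap_apply (f.continuous.sub (hW.continuous_variance.div_const 2)) t

lemma IsGaussianFieldWithVariogram.measurable_subHalfVariance {Ω : Type*} [MeasurableSpace Ω]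
    {P : Measure Ω} {W : Ω → C(E d, ℝ)} {γ : E d → ℝ} (hW : IsGaussianFieldWithVariogram P W γ) :
    Measurable (subHalfVariance P W) := by
  rw [measurable_continuousMap_iff]
  intro t
  simp_rw [hW.subHalfVariance_apply]
  exact (BrownResnick.measurable_eval t).sub_const _

/-- All `V i` share the variance of `V 0`, so every term is the same measurable function of the pair
`(X i, V i)`, as marking requires. -/
lemma IsBrownResnickData.brownResnickTerm_eq {Ω : Type*} [MeasurableSpace Ω] {P : Measure Ω}
    {X : ℕ → Ω → ℝ} {V : ℕ → Ω → C(E d, ℝ)} {γ : E d → ℝ} (h : IsBrownResnickData P X V γ)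
    (ω : Ω) (t : E d) (i : ℕ) : brownResnickTerm P X V ω t i =
      translate 0 (X i ω) (subHalfVariance P (V 0) (V i ω)) t := by
  have hvar : variance (fun ω => V i ω t) P = variance (fun ω => V 0 ω t) P :=
    ((h.identDistrib i).comp (measurable_eval t)).variance_eq
  rw [brownResnickTerm, drifted, translate_apply, (h.field 0).subHalfVariance_apply, hvar, add_zero,
    add_comm]

lemma IsBrownResnickData.hasPoissonVoids {Ω : Type*} [MeasurableSpace Ω] {P : Measure Ω}
    [IsProbabilityMeasure P] {X : ℕ → Ω → ℝ} {V : ℕ → Ω → C(E d, ℝ)} {γ : E d → ℝ}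
    (h : IsBrownResnickData P X V γ) :
    HasPoissonVoids P (fun i ω => translate 0 (X i ω) (subHalfVariance P (V 0) (V i ω)))
      (functionIntensity P (V 0)) := by
  have hΦ : Measurable (fun p : ℝ × C(E d, ℝ) =>
      translate 0 p.1 (subHalfVariance P (V 0) p.2)) :=
    measurable_translate_uncurry.comp (measurable_const.prodMk (measurable_fst.prodMk
      ((h.field 0).measurable_subHalfVariance.comp measurable_snd)))
  refine h.poisson.hasPoissonVoids (fun i => (h.field i).measurable)
    (fun i => (h.identDistrib i).map_eq) h.indep h.iIndep hΦ ?_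
  have hprod := Measure.map_prod_map expIntensity P measurable_id (h.field 0).measurable
  rw [Measure.map_id] at hprod
  rw [hprod, Measure.map_map hΦ (measurable_id.prodMap (h.field 0).measurable), functionIntensity]
  rfl

lemma IsShiftData.hasPoissonVoids {Ω : Type*} [MeasurableSpace Ω] {P : Measure Ω}
    [IsProbabilityMeasure P] {SU : ℕ → Ω → E d × ℝ} {F : ℕ → Ω → C(E d, ℝ)} {l : ℝ≥0∞}
    {Q : Measure C(E d, ℝ)} (h : IsShiftData P SU F l Q) {Λ : Measure C(E d, ℝ)}
    (hΛ : ((l • (volume : Measure (E d)).prod expIntensity).prod Q).map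
      (fun p => translate (-p.1.1) p.1.2 p.2) = Λ) :
    HasPoissonVoids P (fun i ω => translate (-(SU i ω).1) (SU i ω).2 (F i ω)) Λ := by
  have hΦ : Measurable (fun p : (E d × ℝ) × C(E d, ℝ) => translate (-p.1.1) p.1.2 p.2) :=
    measurable_translate_uncurry.comp (measurable_fst.fst.neg.prodMk
      (measurable_fst.snd.prodMk measurable_snd))
  exact h.poisson.hasPoissonVoids h.measurable h.law h.indep h.iIndep hΦ hΛ

lemma shiftTerm_eq {Ω : Type*} (SU : ℕ → Ω → E d × ℝ) (F : ℕ → Ω → C(E d, ℝ)) (ω : Ω) (t : E d)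
    (i : ℕ) : shiftTerm SU F ω t i = translate (-(SU i ω).1) (SU i ω).2 (F i ω) t := by
  rw [shiftTerm, translate_apply, sub_eq_add_neg, add_comm]

end BrownResnick

end

/-! ### The main theorem -/

theorem mainTheorem6 (d : ℕ) (γ : BrownResnick.E d → ℝ)
    {Ω₀ : Type*} [MeasurableSpace Ω₀] (P₀ : Measure Ω₀) [IsProbabilityMeasure P₀]
    (W : Ω₀ → C(BrownResnick.E d, ℝ))
    (hW : BrownResnick.IsGaussianFieldWithVariogram P₀ W γ)
    (hlim : ∀ᵐ ω ∂P₀, Tendsto (BrownResnick.drifted P₀ W ω)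
      (cocompact (BrownResnick.E d)) atBot) :
    (0 < BrownResnick.lambdaStar P₀ W ∧ BrownResnick.lambdaStar P₀ W < ∞ ∧
      IsProbabilityMeasure (BrownResnick.shapeLaw P₀ W) ∧
      BrownResnick.peakIntensity P₀ W =
        BrownResnick.lambdaStar P₀ W • (volume : Measure (BrownResnick.E d)).prod
          (BrownResnick.expIntensity.prod (BrownResnick.shapeLaw P₀ W))) ∧
    ∀ {Ω₁ : Type*} [MeasurableSpace Ω₁] (P₁ : Measure Ω₁) [IsProbabilityMeasure P₁]
      (X : ℕ → Ω₁ → ℝ) (V : ℕ → Ω₁ → C(BrownResnick.E d, ℝ))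
      {Ω₂ : Type*} [MeasurableSpace Ω₂] (P₂ : Measure Ω₂) [IsProbabilityMeasure P₂]
      (SU : ℕ → Ω₂ → BrownResnick.E d × ℝ) (F : ℕ → Ω₂ → C(BrownResnick.E d, ℝ)),
      BrownResnick.IsBrownResnickData P₁ X V γ →
      BrownResnick.IsShiftData P₂ SU F
        (BrownResnick.lambdaStar P₀ W) (BrownResnick.shapeLaw P₀ W) →
      (∀ᵐ ω ∂P₁, ∀ t, IsGreatest (range (BrownResnick.brownResnickTerm P₁ X V ω t))
        (BrownResnick.brownResnick P₁ X V ω t)) ∧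
      (∀ᵐ ω ∂P₂, ∀ t, IsGreatest (range (BrownResnick.shiftTerm SU F ω t))
        (BrownResnick.shiftProcess SU F ω t)) ∧
      IdentDistrib (BrownResnick.shiftProcess SU F) (BrownResnick.brownResnick P₁ X V)
        P₂ P₁ := by
  refine ⟨⟨hW.lambdaStar_pos hlim, hW.lambdaStar_lt_top hlim,
    hW.isProbabilityMeasure_shapeLaw hlim, hW.peakIntensity_eq_smul_prod hlim⟩, ?_⟩
  intro Ω₁ _ P₁ _ X V Ω₂ _ P₂ _ SU F hXV hSF
  have hΛ : ∀ K : Set (BrownResnick.E d), IsCompact K → ∀ c : ℝ,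
      BrownResnick.functionIntensity P₀ W {f | ∃ t ∈ K, c < f t} < ∞ := fun K hK c =>
    hW.functionIntensity_exists_gt_lt_top hK c
  have hZ := hXV.hasPoissonVoids
  -- `V 0` and `W` may have different laws; only their common variogram matters here.
  rw [← hW.functionIntensity_eq (hXV.field 0)] at hZ
  have hZ₄ := hSF.hasPoissonVoids (hW.functionIntensity_eq_map_shift hlim).symm
  have hZeq : BrownResnick.brownResnick P₁ X V = fun ω t => ⨆ i, BrownResnick.translate 0 (X i ω)
      (BrownResnick.subHalfVariance P₁ (V 0) (V i ω)) t := by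
    funext ω t
    exact congrArg iSup (funext (hXV.brownResnickTerm_eq ω t))
  have hZ₄eq : BrownResnick.shiftProcess SU F = fun ω t => ⨆ i,
      BrownResnick.translate (-(SU i ω).1) (SU i ω).2 (F i ω) t := by
    funext ω t
    exact congrArg iSup (funext (BrownResnick.shiftTerm_eq SU F ω t))
  refine ⟨?_, ?_, ?_⟩
  · rw [hZeq]
    filter_upwards [hZ.ae_isGreatest hΛ] with ω hω t
    rw [funext (hXV.brownResnickTerm_eq ω t)]
    exact hω t
  · rw [hZ₄eq]
    filter_upwards [hZ₄.ae_isGreatest hΛ] with ω hω t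
    rw [funext (BrownResnick.shiftTerm_eq SU F ω t)]
    exact hω t
  · rw [hZeq, hZ₄eq]
    exact BrownResnick.identDistrib_iSup hZ₄ hZ hΛ
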